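/- **Setting.** Fix a nonempty set $V$ of values and, for each side $k\in\{1,2\}$, a set $C_k$ of classical variables and a finite set $Q_k$ of quantum variables, each $q\in Q_k$ with a nonzero finite-dimensional Hilbert space with a fixed orthonormal basis. Put $\Sigma_k=V^{C_k}$ (classical states) and let $\mathcal H_k$ be the tensor product of the spaces of all $q\in Q_k$. *Infinite-valued predicates* on a finite-dimensional $\mathcal H$ are objects $A=\sum_i\lambda_i|b_i\rangle\langle b_i|$ with $(b_i)$ an orthonormal basis and $\lambda_i\in[0,\infty]$; $A$ is identified with the quadratic form $\langle u|A|u\rangle=\sum_i\lambda_i|\langle b_i|u\rangle|^2$ ($0\cdot\infty=0$). The operations $A+B$, $rA$ ($r\in[0,\infty]$), arbitrary sums, $K^\dagger AK$, $A\otimes I$, $I\otimes A$ and the order $A\sqsubseteq B$ are those of the quadratic forms ($A\otimes I$ has the form $w=\sum_j w_j\otimes|j\rangle\mapsto\sum_j\langle w_j|A|w_j\rangle$; similarly $I\otimes A$). For $\rho\ge0$, $\operatorname{tr}(A\rho)=\sum_i\lambda_i\langle b_i|\rho|b_i\rangle$. For a condition $b$, $b\mid A$ is $A$ if $b$ holds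 and $\infty\cdot I$ otherwise. A *cq-state* over a set $\mathcal A$ and $\mathcal H$ is a function $\Delta$ from $\mathcal A$ to positive semidefinite operators on $\mathcal H$ with $\operatorname{tr}\Delta:=\sum_a\operatorname{tr}\Delta(a)\le1$. For $\phi$ from $\mathcal A$ to infinite-valued predicates, $\mathbb E_\Delta[\phi]=\sum_a\operatorname{tr}(\phi(a)\Delta(a))\in[0,\infty]$. A cq-state $\Delta$ over $\mathcal A_1\times\mathcal A_2$ and $\mathcal H_1\otimes\mathcal H_2$ has marginals $\operatorname{tr}_2\Delta=\big(a_1\mapsto\sum_{a_2}\operatorname{tr}_2\Delta(a_1,a_2)\big)$ and $\operatorname{tr}_1\Delta=\big(a_2\mapsto\sum_{a_1}\operatorname{tr}_1\Delta(a_1,a_2)\big)$, and is a *coupling* of $\langle\operatorname{tr}_2\Delta,\operatorname{tr}_1\Delta\rangle$. *Relational assertions* $\psi,\phi$ are functions from $\Sigma_1\times\Sigma_2$ to infinite-valued predicates on $\mathcal H_1\otimes\mathcal H_2$; *relational states* are cq-states over $\Sigma_1\times\Sigma_2$ and $\mathcal H_1\otimes\mathcal H_2$. **Commands** (on one side; indices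 dropped): $$c::=\mathbf{skip}\mid\mathbf{abort}\mid x:=e\mid x\stackrel{\$}{\leftarrow}\mu\mid \bar q:=|v\rangle\mid U[\bar q]\mid x:=M[\bar q]\mid c;c\mid\mathbf{if}\ b\ \mathbf{then}\ c\ \mathbf{else}\ c\mid\mathbf{while}\ b\ \mathbf{do}\ c$$ where $x\in C$, $e:\Sigma\to V$, $b:\Sigma\to\{\text{true},\text{false}\}$, $\mu$ is a discrete probability distribution on $V$, $\bar q\subseteq Q$, $v$ is a function from $\Sigma$ to unit vectors of $\bar q$, $U$ is a unitary on $\bar q$, and $M=(M_v)_{v\in V}$ are operators on $\bar q$ with $\sum_vM_v^\dagger M_v=I$. Write $\mathsf{Eval}(\mu)(\rho)(v)=\mu(v)\rho$, $\mathsf{Eval}(M[\bar q])(\rho)(v)=M_v\rho M_v^\dagger$ (operators on $\bar q$ are extended by the identity), $\langle\sigma,\rho\rangle$ for the function with value $\rho$ at $\sigma$ and $0$ elsewhere, $\Delta|_b$ for the restriction of $\Delta$ to the $\sigma$ with $b(\sigma)$ true, and $r_b(\Delta)=\Delta|_b$. The semantics $[\![c]\!]$ maps cq-states over $\Sigma,\mathcal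 H$ to such: - $[\![\mathbf{skip}]\!]\Delta=\Delta$; $[\![\mathbf{abort}]\!]\Delta=0$; $[\![x:=e]\!]\Delta=\sum_\sigma\langle\sigma[e(\sigma)/x],\Delta(\sigma)\rangle$; - $[\![x\stackrel{\$}{\leftarrow}\mu]\!]\Delta=\sum_{\sigma,v}\langle\sigma[v/x],\mathsf{Eval}(\mu)(\Delta(\sigma))(v)\rangle$, and likewise for $x:=M[\bar q]$ with $\mathsf{Eval}(M[\bar q])$; - $[\![\bar q:=|v\rangle]\!]\Delta=\big(\sigma\mapsto\sum_i|v(\sigma)\rangle\langle i|\,\Delta(\sigma)\,|i\rangle\langle v(\sigma)|\big)$, over the basis vectors $|i\rangle$ of $\bar q$; $[\![U[\bar q]]\!]\Delta=(\sigma\mapsto U\Delta(\sigma)U^\dagger)$; - $[\![c;c']\!]=[\![c']\!]\circ[\![c]\!]$; $[\![\mathbf{if}\ b\ \mathbf{then}\ c\ \mathbf{else}\ c']\!]\Delta=[\![c]\!](\Delta|_b)+[\![c']\!](\Delta|_{\neg b})$; $[\![\mathbf{while}\ b\ \mathbf{do}\ c]\!]=\sum_{i\ge0}r_{\neg b}\circ([\![c]\!]\circ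 r_b)^i$. A command $c$ is *AST* (almost surely terminating) if $\operatorname{tr}[\![c]\!]\Delta=\operatorname{tr}\Delta$ for all cq-states $\Delta$, and *HAST* (hereditarily AST) if $c$ and all its subcommands are AST. $\mathsf{Mod}(c)$ is the set of classical variables on the left of an assignment, a sampling or a measurement in $c$. **Validity.** $\vDash\{\psi\}c_1\sim c_2\{\phi\}$ means: for every relational state $\Delta$ there is a coupling $\Delta'$ of $\langle[\![c_1]\!]\operatorname{tr}_2\Delta,\ [\![c_2]\!]\operatorname{tr}_1\Delta\rangle$ with $\mathbb E_{\Delta'}[\phi]\le\mathbb E_\Delta[\psi]$. **Derivability.** $\vdash\{\psi\}c_1\sim c_2\{\phi\}$ is the least relation closed under the following (possibly infinitary) rules, in which commands are identified up to $\mathbf{skip};c=c=c;\mathbf{skip}$ (as rules: a judgment holds if it holds with $c_1$ replaced by $\mathbf{skip};c_1$ or $c_1;\mathbf{skip}$, or the same for $c_2$). Updates $[\cdot/x_1]$, $[\cdot/x_2]$ act on the left and right classical state; an operator of one side is extended by the identity of the other. *One-sided rules* (left versions; the symmetric right versions are also rules): - $\{\psi[e/x_1]\}\,x_1:=e\sim\mathbf{skip}\,\{\psi\}$;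 $\ \{\sum_v\mu(v)\,\psi[v/x_1]\}\,x_1\stackrel{\$}{\leftarrow}\mu\sim\mathbf{skip}\,\{\psi\}$; $\ \{\sum_vM_v^\dagger\,\psi[v/x_1]\,M_v\}\,x_1:=M[\bar q]\sim\mathbf{skip}\,\{\psi\}$; - $\{\sum_i|i\rangle\langle v|\,\psi\,|v\rangle\langle i|\}\,\bar q:=|v\rangle\sim\mathbf{skip}\,\{\psi\}$; $\ \{U^\dagger\psi U\}\,U[\bar q]\sim\mathbf{skip}\,\{\psi\}$; - from $\{b\mid\psi\}c\sim c_2\{\phi\}$ and $\{\neg b\mid\psi\}c'\sim c_2\{\phi\}$ infer $\{\psi\}\,\mathbf{if}\ b\ \mathbf{then}\ c\ \mathbf{else}\ c'\sim c_2\,\{\phi\}$; - from $\{b\mid\psi\}c\sim\mathbf{skip}\{\psi\}$, if $\mathbf{while}\ b\ \mathbf{do}\ c$ is AST, infer $\{\psi\}\,\mathbf{while}\ b\ \mathbf{do}\ c\sim\mathbf{skip}\,\{\neg b\mid\psi\}$. *Two-sided rules*: - $\{\psi\}\mathbf{skip}\sim\mathbf{skip}\{\psi\}$; $\ \{\psi[e_1/x_1,e_2/x_2]\}\,x_1:=e_1\sim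 x_2:=e_2\,\{\psi\}$; - from $\{\psi\}c_1\sim c_2\{\xi\}$ and $\{\xi\}c_1'\sim c_2'\{\phi\}$ infer $\{\psi\}c_1;c_1'\sim c_2;c_2'\{\phi\}$; - from $\{b_1\wedge b_2\mid\psi\}c_1\sim c_2\{\phi\}$ and $\{\neg b_1\wedge\neg b_2\mid\psi\}c_1'\sim c_2'\{\phi\}$ infer $\{b_1\leftrightarrow b_2\mid\psi\}\,\mathbf{if}\ b_1\ \mathbf{then}\ c_1\ \mathbf{else}\ c_1'\sim\mathbf{if}\ b_2\ \mathbf{then}\ c_2\ \mathbf{else}\ c_2'\,\{\phi\}$; - from $\{b_1\wedge b_2\mid\psi\}c_1\sim c_2\{b_1\leftrightarrow b_2\mid\psi\}$ infer $\{b_1\leftrightarrow b_2\mid\psi\}\,\mathbf{while}\ b_1\ \mathbf{do}\ c_1\sim\mathbf{while}\ b_2\ \mathbf{do}\ c_2\,\{\neg b_1\wedge\neg b_2\mid\psi\}$; - if $c_1,c_2$ are two samplings, two measurements, or a measurement and a sampling, with targets $x_1,x_2$ and evaluation functions $g_1,g_2$, infer $\{\psi\}c_1\sim c_2\{\phi\}$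 from the *coupling condition*: for all $(\sigma_1,\sigma_2)$ and all $\rho\ge0$ on $\mathcal H_1\otimes\mathcal H_2$ with $\operatorname{tr}\rho\le1$ there is a coupling $\Delta$ (a cq-state over $V\times V$) of $\langle g_1(\operatorname{tr}_2\rho),g_2(\operatorname{tr}_1\rho)\rangle$ with $\sum_{i,j}\operatorname{tr}\big(\phi[i/x_1,j/x_2](\sigma_1,\sigma_2)\,\Delta(i,j)\big)\le\operatorname{tr}(\psi(\sigma_1,\sigma_2)\rho)$. *Structural rules*: - (Conseq) from $\{\psi'\}c_1\sim c_2\{\phi'\}$ infer $\{\psi\}c_1\sim c_2\{\phi\}$ if for all cq-states $\Delta,\Delta_1,\Delta_2$ of the relational, left and right kind, $\mathbb E_\Delta[\psi']\ge\inf_{\Delta'}\mathbb E_{\Delta'}[\phi']$ implies $\mathbb E_\Delta[\psi]\ge\inf_{\Delta'}\mathbb E_{\Delta'}[\phi]$, the infima over the couplings $\Delta'$ of $\langle\Delta_1,\Delta_2\rangle$ ($\inf\emptyset=\infty$); - (NMod) if $x_1\in C_1\setminus\mathsf{Mod}(c_1)$, from $\{x_1=v\mid\psi\}c_1\sim c_2\{\phi[v/x_1]\}$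 for all $v\in V$ infer $\{\psi\}c_1\sim c_2\{\phi\}$; - (Unbounded-Duality) if $c_1,c_2$ are AST, from $\{\psi+n\cdot I\}c_1\sim c_2\{\phi_1\otimes I+I\otimes\phi_2\}$ for all $(n,\phi_1,\phi_2)\in\mathcal Y(\phi)$ infer $\{\psi\}c_1\sim c_2\{\phi\}$, where $\mathcal Y(\phi)$ is the set of all $n\in\mathbb N$ and functions $\phi_k$ from $\Sigma_k$ to infinite-valued predicates on $\mathcal H_k$ such that each $\phi_k$ is bounded ($\phi_k(\sigma)\sqsubseteq L\cdot I$ for all $\sigma$, for a finite constant $L$) and $\phi_1(\sigma_1)\otimes I+I\otimes\phi_2(\sigma_2)\sqsubseteq\phi(\sigma_1,\sigma_2)+n\cdot I$ for all $\sigma_1,\sigma_2$; - (Limit) from $\{\psi\}c_1\sim c_2\{\phi_k\}$ for all $k\in\mathbb N$ infer $\{\psi\}c_1\sim c_2\{\phi\}$ if $\phi_k\sqsubseteq\phi_{k+1}$ for all $k$ and $\phi_k\to\phi$ pointwise. **Theorem (Completeness).** For all HAST commands $c_1$ and $c_2$ and all relational assertions $\psi,\phi$, $$\vDash\{\psi\}c_1\sim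 c_2\{\phi\}\quad\Longrightarrow\quad\vdash\{\psi\}c_1\sim c_2\{\phi\}.$$ -/

import Mathlib

open scoped ENNReal NNReal Matrix ComplexOrder Topology
noncomputable section
namespace CqOTL

/-! ### Infinite-valued predicates -/

/-- An additive function that is bounded on the unit interval is linear. -/
theorem additive_bdd_linear (a : ℝ → ℝ) (ha : ∀ s t, a (s + t) = a s + a t) (C : ℝ)
    (hC : ∀ t, 0 ≤ t → t ≤ 1 → |a t| ≤ C) (t : ℝ) : a t = t * a 1 := by
  let A : ℝ →+ ℝ := AddMonoidHom.mk' a ha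
  let b : ℝ →+ ℝ := A - (AddMonoidHom.mulRight (a 1))
  have hb : ∀ t, b t = a t - t * a 1 := fun t => rfl
  have hb1 : b 1 = 0 := by simp [hb]
  have hbz : ∀ k : ℤ, b (k : ℝ) = 0 := fun k => by
    have := map_zsmul b k (1 : ℝ)
    simpa [hb1] using this
  have hbd : ∀ t, |b t| ≤ C + |a 1| := fun t => by
    have h : b t = b (Int.fract t) := by
      conv_lhs => rw [← Int.floor_add_fract t, map_add, hbz, zero_add]
    rw [h, hb]
    have h0 := Int.fract_nonneg t
    have h1 := (Int.fract_lt_one t).le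
    calc |a (Int.fract t) - Int.fract t * a 1| ≤ |a (Int.fract t)| + |Int.fract t * a 1| := abs_sub _ _
      _ ≤ C + |a 1| := add_le_add (hC _ h0 h1) (by
        rw [abs_mul, abs_of_nonneg h0]
        exact mul_le_of_le_one_left (abs_nonneg _) h1)
  have hz : b t = 0 := by
    by_contra hne
    obtain ⟨N, hN⟩ := exists_nat_gt ((C + |a 1|) / |b t|)
    have hp : 0 < |b t| := abs_pos.mpr hne
    rw [div_lt_iff₀ hp] at hN
    have h2 := hbd (N * t)
    have h3 : b (N * t) = N * b t := by
      have := map_nsmul b N t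
      simpa using this
    rw [h3, abs_mul, Nat.abs_cast] at h2
    linarith
  have := hb t
  linarith

section InfPred

variable {n m : Type*} [Fintype n] [DecidableEq n] [Fintype m] [DecidableEq m]

/-- A real function that satisfies the parallelogram law, and is nonnegative and homogeneous of
degree two, is the quadratic form of a positive semidefinite matrix. -/
theorem exists_posSemidef_of_parallelogram (f : (n → ℂ) → ℝ) (h0 : ∀ u, 0 ≤ f u)
    (hs : ∀ (c : ℂ) u, f (c • u) = ‖c‖ ^ 2 * f u)
    (hp : ∀ u v, f (u + v) + f (u - v) = 2 * f u + 2 * f v) :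
    ∃ P : Matrix n n ℂ, P.PosSemidef ∧ ∀ u, (f u : ℂ) = star u ⬝ᵥ (P *ᵥ u) := by
  have hneg : ∀ u, f (-u) = f u := fun u => by
    have := hs (-1) u
    simpa using this
  have hz : f 0 = 0 := by simpa using hs 0 0
  let g : (n → ℂ) → (n → ℂ) → ℝ := fun u v => f (u + v) - f (u - v)
  have gdef : ∀ u v, g u v = f (u + v) - f (u - v) := fun _ _ => rfl
  have gsymm : ∀ u v, g u v = g v u := fun u v => by
    rw [gdef, gdef, add_comm, ← hneg (u - v), neg_sub]
  have key : ∀ u u' v, g (u + u') (v + v) = 2 * g u v + 2 * g u' v := fun u u' v => by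
    have e1 := hp (u + v) (u' + v)
    have e2 := hp (u - v) (u' - v)
    rw [show u + v + (u' + v) = u + u' + (v + v) by abel,
      show u + v - (u' + v) = u - u' by abel] at e1
    rw [show u - v + (u' - v) = u + u' - (v + v) by abel,
      show u - v - (u' - v) = u - u' by abel] at e2
    simp only [gdef]
    linarith
  have g0 : ∀ v, g 0 v = 0 := fun v => by simp [gdef, hneg]
  have gdbl : ∀ u v, g u (v + v) = 2 * g u v := fun u v => by
    have := key u 0 v
    simpa [g0] using this
  have gadd : ∀ u u' v, g (u + u') v = g u v + g u' v := fun u u' v => by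
    have h1 := key u u' v
    rw [gdbl] at h1
    linarith
  have gsmul : ∀ (t : ℝ) u v, g ((t : ℂ) • u) v = t * g u v := fun t u v => by
    have := additive_bdd_linear (fun s => g ((s : ℂ) • u) v)
      (fun s s' => by simp only [Complex.ofReal_add, add_smul, gadd])
      (2 * (f u + f v)) (fun s hs0 hs1 => by
        have e := hp ((s : ℂ) • u) v
        have p1 := h0 ((s : ℂ) • u + v)
        have p2 := h0 ((s : ℂ) • u - v)
        have e2 : f ((s : ℂ) • u) ≤ f u := by
          rw [hs, Complex.norm_real, Real.norm_of_nonneg hs0]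
          exact mul_le_of_le_one_left (h0 u) (by nlinarith)
        rw [gdef, abs_le]
        constructor <;> linarith) t
    simpa using this
  have gI : ∀ u v, g (Complex.I • u) (Complex.I • v) = g u v := fun u v => by
    simp [gdef, ← smul_add, ← smul_sub, hs]
  have gaddr : ∀ u v v', g u (v + v') = g u v + g u v' := fun u v v' => by
    rw [gsymm, gadd, gsymm v, gsymm v']
  have gsmulr : ∀ (t : ℝ) u v, g u ((t : ℂ) • v) = t * g u v := fun t u v => by
    rw [gsymm, gsmul, gsymm]
  have gnegr : ∀ u v, g u (-v) = - g u v := fun u v => by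
    simpa using gsmulr (-1) u v
  have gnegl : ∀ u v, g (-u) v = - g u v := fun u v => by
    simpa using gsmul (-1) u v
  have gI2 : ∀ u v, g u (Complex.I • v) = - g (Complex.I • u) v := fun u v => by
    rw [← gI u, smul_smul, Complex.I_mul_I, neg_one_smul, gnegr]
  let B : (n → ℂ) → (n → ℂ) → ℂ := fun u v =>
    (1 / 4 : ℂ) * (g u v + Complex.I * g (Complex.I • u) v)
  have Badd : ∀ u v v', B u (v + v') = B u v + B u v' := fun u v v' => by
    simp only [B, gaddr]; push_cast; ring
  have Bsmul : ∀ (c : ℂ) u v, B u (c • v) = c * B u v := fun c u v => by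
    have e : c • v = (c.re : ℂ) • v + (c.im : ℂ) • (Complex.I • v) := by
      rw [smul_smul, ← add_smul, Complex.re_add_im]
    have e' : ∀ w, g w (c • v) = c.re * g w v - c.im * g (Complex.I • w) v := fun w => by
      rw [e, gaddr, gsmulr, gsmulr, gI2]; ring
    simp only [B, e', smul_smul, Complex.I_mul_I, neg_one_smul, gnegl]
    conv_rhs => rw [← Complex.re_add_im c]
    push_cast
    ring_nf
    simp only [Complex.I_sq]
    ring
  have Bstar : ∀ u v, B v u = star (B u v) := fun u v => by
    have : g (Complex.I • v) u = - g (Complex.I • u) v := by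
      rw [gsymm, gI2]
    simp only [B, gsymm v u, this]
    simp
  have Baddl : ∀ u u' v, B (u + u') v = B u v + B u' v := fun u u' v => by
    rw [Bstar, Badd, star_add, ← Bstar, ← Bstar]
  have Bsmull : ∀ (c : ℂ) u v, B (c • u) v = star c * B u v := fun c u v => by
    rw [Bstar, Bsmul, star_mul', ← Bstar]
  have Bself : ∀ u, B u u = f u := fun u => by
    have e1 : g u u = 4 * f u := by
      rw [gdef, sub_self, hz, ← two_smul ℂ u, hs]; norm_num
    have e2 : g (Complex.I • u) u = 0 := by
      have h1 := gI2 u u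
      rw [gsymm] at h1
      linarith
    simp only [B, e1, e2]
    push_cast
    ring
  let P : Matrix n n ℂ := Matrix.of fun i j => B (Pi.single i 1) (Pi.single j 1)
  have hP : ∀ u, (f u : ℂ) = star u ⬝ᵥ (P *ᵥ u) := fun u => by
    let L : (n → ℂ) → (n → ℂ) →ₗ[ℂ] ℂ := fun w =>
      { toFun := B w, map_add' := Badd w, map_smul' := fun c v => by simp [Bsmul] }
    let R : (n → ℂ) → (n → ℂ) →+ ℂ := fun v => AddMonoidHom.mk' (fun w => B w v)
      (fun a b => Baddl a b v)
    have hu : u = ∑ i, u i • (Pi.single i 1 : n → ℂ) := pi_eq_sum_univ' u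
    have h1 : B u u = ∑ i, star (u i) * B (Pi.single i 1) u := by
      have : R u u = ∑ i, R u (u i • Pi.single i 1) := by
        conv_lhs => rw [hu]
        rw [map_sum, ← hu]
      simpa [R, Bsmull] using this
    have h2 : ∀ i, B (Pi.single i 1) u = ∑ j, P i j * u j := fun i => by
      have : L (Pi.single i 1) u = ∑ j, u j • L (Pi.single i 1) (Pi.single j 1) := by
        conv_lhs => rw [hu]
        simp only [map_sum, map_smul]
      simpa [L, P, mul_comm] using this
    rw [← Bself, h1]
    simp only [h2, dotProduct, Matrix.mulVec, Pi.star_apply]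
  refine ⟨P, Matrix.PosSemidef.of_dotProduct_mulVec_nonneg ?_ fun u => ?_, hP⟩
  · ext i j
    simp only [Matrix.conjTranspose_apply, P, Matrix.of_apply]
    exact (Bstar _ _).symm
  · rw [← hP]
    exact_mod_cast h0 u

/-- An extended-valued function that satisfies the parallelogram law and is homogeneous of degree
two has a spectral decomposition with eigenvalues in the interval from `0` to `∞`. -/
theorem exists_spectral (q : (n → ℂ) → ℝ≥0∞)
    (hs : ∀ (c : ℂ) u, q (c • u) = ‖c‖ₑ ^ 2 * q u)
    (hp : ∀ u v, q (u + v) + q (u - v) = 2 * q u + 2 * q v) :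
    ∃ (U : Matrix.unitaryGroup n ℂ) (lam : n → ℝ≥0∞),
      ∀ u, q u = ∑ i, lam i * ‖((U : Matrix n n ℂ)ᴴ *ᵥ u) i‖ₑ ^ 2 := by
  have hq0 : q 0 = 0 := by simpa using hs 0 0
  -- the domain of finiteness
  let D : Submodule ℂ (EuclideanSpace ℂ n) :=
    { carrier := {u | q u.ofLp ≠ ⊤}
      add_mem' := by
        intro a b ha hb
        have h : q (a.ofLp + b.ofLp) ≤ 2 * q a.ofLp + 2 * q b.ofLp := by
          rw [← hp]; exact le_self_add
        refine ne_top_of_le_ne_top ?_ h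
        simp only [Set.mem_ofPred_eq] at ha hb
        finiteness
      zero_mem' := by simp [hq0]
      smul_mem' := by
        intro c a ha
        simp only [Set.mem_ofPred_eq] at ha ⊢
        rw [WithLp.ofLp_smul, hs]
        finiteness }
  have memD : ∀ u : n → ℂ, WithLp.toLp 2 u ∈ D ↔ q u ≠ ⊤ := fun u => Iff.rfl
  let T : (n → ℂ) →ₗ[ℂ] (n → ℂ) := (WithLp.linearEquiv 2 ℂ (n → ℂ)).toLinearMap ∘ₗ
    D.starProjection.toLinearMap ∘ₗ (WithLp.linearEquiv 2 ℂ (n → ℂ)).symm.toLinearMap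
  have Tdef : ∀ u, WithLp.toLp 2 (T u) = D.starProjection (WithLp.toLp 2 u) := fun u => rfl
  have TD : ∀ u, q (T u) ≠ ⊤ := fun u => by
    rw [← memD, Tdef]; exact D.starProjection_apply_mem _
  have Tfix : ∀ u, q u ≠ ⊤ ↔ T u = u := fun u => by
    rw [← memD, ← Submodule.starProjection_eq_self_iff, ← Tdef]
    exact (WithLp.toLp_injective 2).eq_iff
  have Tsymm : ∀ u v, star (T u) ⬝ᵥ v = star u ⬝ᵥ T v := fun u v => by
    have := D.inner_starProjection_left_eq_right (WithLp.toLp 2 u) (WithLp.toLp 2 v)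
    rw [← Tdef, ← Tdef, EuclideanSpace.inner_toLp_toLp, EuclideanSpace.inner_toLp_toLp] at this
    rw [dotProduct_comm, this, dotProduct_comm]
  have Tidem : ∀ u, T (T u) = T u := fun u => (Tfix _).1 (TD u)
  obtain ⟨P, hP, hPf⟩ := exists_posSemidef_of_parallelogram (fun u => (q (T u)).toReal)
    (fun _ => ENNReal.toReal_nonneg)
    (fun c u => by
      simp only [map_smul, hs, ENNReal.toReal_mul, ENNReal.toReal_pow, toReal_enorm])
    (fun u v => by
      have h1 := TD u
      have h2 := TD v
      have h3 := TD (u + v)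
      have h4 := TD (u - v)
      rw [← ENNReal.toReal_add h3 h4, map_add, map_sub, hp, ENNReal.toReal_add (by finiteness)
        (by finiteness)]
      simp)
  let Q : Matrix n n ℂ := LinearMap.toMatrix' (LinearMap.id - T)
  have hQ : ∀ u, Q *ᵥ u = u - T u := fun u => by
    exact LinearMap.toMatrix'_mulVec (LinearMap.id - T) u
  have hQd : ∀ u v, star u ⬝ᵥ (Q *ᵥ v) = star (Q *ᵥ u) ⬝ᵥ v := fun u v => by
    rw [hQ, hQ, star_sub, dotProduct_sub, sub_dotProduct, Tsymm]
  have hQh : Q.IsHermitian := by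
    rw [Matrix.IsHermitian]
    apply Matrix.ext_of_mulVec_single
    intro j
    ext i
    have := hQd (Pi.single i 1) (Pi.single j 1)
    simpa [Matrix.mulVec_single_one, Matrix.col, Pi.star_single] using this.symm
  have hPQ : ∀ u, P *ᵥ (Q *ᵥ u) = 0 := fun u => by
    rw [← hP.dotProduct_mulVec_zero_iff, ← hPf, hQ, map_sub, Tidem, sub_self, hq0]
    simp
  have hQP : ∀ u, Q *ᵥ (P *ᵥ u) = 0 := fun u => by
    have h : P * Q = 0 := Matrix.ext_of_mulVec_single fun i => by
      rw [← Matrix.mulVec_mulVec, hPQ, Matrix.zero_mulVec]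
    have h' : Q * P = 0 := by
      have := congrArg Matrix.conjTranspose h
      rwa [Matrix.conjTranspose_mul, hQh, hP.isHermitian, Matrix.conjTranspose_zero] at this
    rw [Matrix.mulVec_mulVec, h', Matrix.zero_mulVec]
  have hQQ : ∀ u, Q *ᵥ (Q *ᵥ u) = Q *ᵥ u := fun u => by
    simp [hQ, Tidem]
  have hK : (P - Q).IsHermitian := hP.isHermitian.sub hQh
  set U := hK.eigenvectorUnitary
  set mu := hK.eigenvalues
  let v : n → n → ℂ := fun j => ⇑(hK.eigenvectorBasis j)
  have hKv : ∀ j, P *ᵥ v j - Q *ᵥ v j = (mu j : ℂ) • v j := fun j => by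
    have := hK.mulVec_eigenvectorBasis j
    rw [Matrix.sub_mulVec] at this
    rw [this]
    ext i
    simp [v, mu]
  have hneg : ∀ j, mu j < 0 → T (v j) = 0 := fun j hj => by
    have e1 : P *ᵥ (P *ᵥ v j) = (mu j : ℂ) • (P *ᵥ v j) := by
      have := congrArg (P *ᵥ ·) (hKv j)
      simpa [Matrix.mulVec_sub, hPQ, Matrix.mulVec_smul] using this
    have e2 : P *ᵥ v j = 0 := by
      have h1 : 0 ≤ star (P *ᵥ v j) ⬝ᵥ (P *ᵥ v j) := dotProduct_star_self_nonneg _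
      have h2 : star (P *ᵥ v j) ⬝ᵥ (P *ᵥ v j) = mu j * (star (v j) ⬝ᵥ (P *ᵥ v j)) := by
        rw [← smul_eq_mul, ← dotProduct_smul, ← e1, Matrix.star_mulVec, hP.isHermitian,
          ← Matrix.dotProduct_mulVec]
      have h3 := hP.dotProduct_mulVec_nonneg (v j)
      have h4 : star (P *ᵥ v j) ⬝ᵥ (P *ᵥ v j) ≤ 0 := by
        rw [h2]
        exact mul_nonpos_of_nonpos_of_nonneg (by exact_mod_cast hj.le) h3
      exact dotProduct_star_self_eq_zero.1 (le_antisymm h4 h1)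
    have e3 := hKv j
    rw [e2, zero_sub] at e3
    have e4 : T (Q *ᵥ v j) = 0 := by simp [hQ, Tidem]
    have e5 : (mu j : ℂ) • T (v j) = 0 := by
      rw [← map_smul, ← e3, map_neg, e4, neg_zero]
    exact (smul_eq_zero.1 e5).resolve_left (by exact_mod_cast hj.ne)
  have hpos : ∀ j, 0 ≤ mu j → Q *ᵥ v j = 0 := fun j hj => by
    have := congrArg (Q *ᵥ ·) (hKv j)
    simp only [Matrix.mulVec_sub, hQP, hQQ, Matrix.mulVec_smul, zero_sub] at this
    have h2 : ((mu j : ℂ) + 1) • (Q *ᵥ v j) = 0 := by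
      rw [add_smul, ← this, one_smul, neg_add_cancel]
    refine (smul_eq_zero.1 h2).resolve_left ?_
    have : mu j + 1 ≠ 0 := by positivity
    exact_mod_cast this
  -- coordinates in the eigenbasis
  let y : (n → ℂ) → n → ℂ := fun u => (U : Matrix n n ℂ)ᴴ *ᵥ u
  have yv : ∀ u j, y u j = star (v j) ⬝ᵥ u := fun u j => by
    simp [y, v, U, Matrix.mulVec, dotProduct, Matrix.conjTranspose_apply,
      Matrix.IsHermitian.eigenvectorUnitary_apply]
  have hexp : ∀ u, u = ∑ j, y u j • v j := fun u => by
    have h : (U : Matrix n n ℂ) *ᵥ y u = u := by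
      simp only [y]
      rw [Matrix.mulVec_mulVec, ← Matrix.star_eq_conjTranspose, Matrix.mem_unitaryGroup_iff.1 U.2,
        Matrix.one_mulVec]
    conv_lhs => rw [← h]
    ext i
    simp [Matrix.mulVec, dotProduct, v, U, Matrix.IsHermitian.eigenvectorUnitary_apply, mul_comm]
  have y0 : ∀ u j, q u ≠ ⊤ → mu j < 0 → y u j = 0 := fun u j hu hj => by
    rw [yv, ← (Tfix u).1 hu, ← Tsymm, hneg j hj, star_zero, zero_dotProduct]
  have hquad : ∀ u, star u ⬝ᵥ ((P - Q) *ᵥ u) = ∑ j, (mu j : ℂ) * (star (y u j) * y u j) := by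
    intro u
    conv_lhs =>
      rw [show (P - Q) *ᵥ u = ∑ j, y u j • ((mu j : ℂ) • v j) by
        conv_lhs => rw [hexp u]
        rw [← Matrix.mulVecLin_apply, map_sum]
        refine Finset.sum_congr rfl fun j _ => ?_
        rw [map_smul, Matrix.mulVecLin_apply, Matrix.sub_mulVec, hKv]]
    rw [dotProduct_sum]
    refine Finset.sum_congr rfl fun j _ => ?_
    rw [dotProduct_smul, dotProduct_smul, yv u j, ← Matrix.star_dotProduct_star, star_star]
    simp only [smul_eq_mul]
    ring
  refine ⟨U, fun j => if mu j < 0 then ⊤ else ENNReal.ofReal (mu j), fun u => ?_⟩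
  change q u = ∑ j, _ * ‖y u j‖ₑ ^ 2
  by_cases hu : q u = ⊤
  · have : ∃ j, mu j < 0 ∧ y u j ≠ 0 := by
      by_contra! hcon
      refine (Tfix u).2 ?_ hu
      have : Q *ᵥ u = 0 := by
        rw [hexp u, ← Matrix.mulVecLin_apply, map_sum]
        refine Finset.sum_eq_zero fun j _ => ?_
        rw [map_smul, Matrix.mulVecLin_apply]
        rcases lt_or_ge (mu j) 0 with h | h
        · rw [hcon j h, zero_smul]
        · rw [hpos j h, smul_zero]
      rw [hQ, sub_eq_zero] at this
      exact this.symm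
    obtain ⟨j, hj, hyj⟩ := this
    rw [hu, eq_comm, ENNReal.sum_eq_top]
    refine ⟨j, Finset.mem_univ _, ?_⟩
    rw [if_pos hj, ENNReal.top_mul]
    simpa using hyj
  · have hTu := (Tfix u).1 hu
    have hQu : Q *ᵥ u = 0 := by rw [hQ, hTu, sub_self]
    have e1 : ((q u).toReal : ℂ) = ((∑ j, mu j * ‖y u j‖ ^ 2 : ℝ) : ℂ) := by
      have h1 := hPf u
      rw [hTu] at h1
      rw [h1, show P *ᵥ u = (P - Q) *ᵥ u by rw [Matrix.sub_mulVec, hQu, sub_zero], hquad]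
      push_cast
      refine Finset.sum_congr rfl fun j _ => ?_
      rw [Complex.star_def, Complex.conj_mul']
    have e2 : (q u).toReal = ∑ j, mu j * ‖y u j‖ ^ 2 := by exact_mod_cast e1
    have e3 : ∀ j, 0 ≤ mu j * ‖y u j‖ ^ 2 := fun j => by
      rcases lt_or_ge (mu j) 0 with h | h
      · simp [y0 u j hu h]
      · positivity
    rw [← ENNReal.ofReal_toReal hu, e2, ENNReal.ofReal_sum_of_nonneg fun j _ => e3 j]
    refine Finset.sum_congr rfl fun j _ => ?_
    rcases lt_or_ge (mu j) 0 with h | h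
    · simp [y0 u j hu h]
    · rw [if_neg h.not_gt, ENNReal.ofReal_mul h, ENNReal.ofReal_pow (norm_nonneg _), ofReal_norm]

/-- An infinite-valued predicate on the Hilbert space with orthonormal basis `n`: an object
`A = ∑ i, lam i • |b i⟩⟨b i|` with `b` an orthonormal basis (the columns of `U`) and eigenvalues
`lam i` in `[0, ∞]`. It is recorded by its quadratic form `u ↦ ⟨u|A|u⟩ = ∑ i, lam i * |⟨b i|u⟩|²`
(with `0 * ∞ = 0`), which determines the eigenvalues and the eigenspaces. -/
@[ext] structure InfPred (n : Type*) [Fintype n] [DecidableEq n] where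
  form : (n → ℂ) → ℝ≥0∞
  spectral : ∃ (U : Matrix.unitaryGroup n ℂ) (lam : n → ℝ≥0∞),
    ∀ u, form u = ∑ i, lam i * ‖((U : Matrix n n ℂ)ᴴ *ᵥ u) i‖ₑ ^ 2

namespace InfPred

theorem form_smul (A : InfPred n) (c : ℂ) (u : n → ℂ) :
    A.form (c • u) = ‖c‖ₑ ^ 2 * A.form u := by
  obtain ⟨U, lam, h⟩ := A.spectral
  simp only [h, Matrix.mulVec_smul, Pi.smul_apply, enorm_smul, mul_pow, Finset.mul_sum]
  exact Finset.sum_congr rfl fun _ _ => by ring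

theorem enorm_parallelogram (a b : ℂ) :
    ‖a + b‖ₑ ^ 2 + ‖a - b‖ₑ ^ 2 = 2 * ‖a‖ₑ ^ 2 + 2 * ‖b‖ₑ ^ 2 := by
  have h := parallelogram_law_with_norm ℝ a b
  simp only [← ofReal_norm]
  rw [← ENNReal.ofReal_pow (by positivity), ← ENNReal.ofReal_pow (by positivity),
    ← ENNReal.ofReal_pow (by positivity), ← ENNReal.ofReal_pow (by positivity),
    ← ENNReal.ofReal_add (by positivity) (by positivity),
    show (2 : ℝ≥0∞) = ENNReal.ofReal 2 by simp, ← ENNReal.ofReal_mul (by positivity),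
    ← ENNReal.ofReal_mul (by positivity), ← ENNReal.ofReal_add (by positivity) (by positivity)]
  congr 1
  nlinarith

theorem form_parallelogram (A : InfPred n) (u v : n → ℂ) :
    A.form (u + v) + A.form (u - v) = 2 * A.form u + 2 * A.form v := by
  obtain ⟨U, lam, h⟩ := A.spectral
  simp only [h, Matrix.mulVec_add, Matrix.mulVec_sub, Pi.add_apply, Pi.sub_apply, Finset.mul_sum,
    ← Finset.sum_add_distrib, ← mul_add, enorm_parallelogram]
  exact Finset.sum_congr rfl fun _ _ => by ring

theorem form_zero (A : InfPred n) : A.form 0 = 0 := by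
  simpa using A.form_smul 0 0

/-- The Löwner order. -/
instance : LE (InfPred n) := ⟨fun A B => ∀ u, A.form u ≤ B.form u⟩

instance : Add (InfPred n) where
  add A B := ⟨fun u => A.form u + B.form u, exists_spectral _
    (fun c u => by rw [A.form_smul, B.form_smul, mul_add])
    (fun u v => by
      rw [add_add_add_comm, A.form_parallelogram, B.form_parallelogram]; ring)⟩

instance : SMul ℝ≥0∞ (InfPred n) where
  smul r A := ⟨fun u => r * A.form u, exists_spectral _
    (fun c u => by rw [A.form_smul]; ring)
    (fun u v => by rw [← mul_add, A.form_parallelogram]; ring)⟩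

/-- The identity operator `I`. -/
instance : One (InfPred n) where
  one := ⟨fun u => ∑ i, ‖u i‖ₑ ^ 2, 1, fun _ => 1, fun u => by simp⟩

/-- The sum of a family of infinite-valued predicates. -/
def sum {ι : Type*} (A : ι → InfPred n) : InfPred n where
  form u := ∑' i, (A i).form u
  spectral := exists_spectral _
    (fun c u => by simp only [form_smul, ENNReal.tsum_mul_left])
    (fun u v => by
      rw [← ENNReal.tsum_add]
      simp only [form_parallelogram, ENNReal.tsum_add, ENNReal.tsum_mul_left])

/-- The predicate `K† A K`. -/
def conj (K : Matrix m n ℂ) (A : InfPred m) : InfPred n where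
  form u := A.form (K *ᵥ u)
  spectral := exists_spectral _
    (fun c u => by rw [Matrix.mulVec_smul, form_smul])
    (fun u v => by rw [Matrix.mulVec_add, Matrix.mulVec_sub, form_parallelogram])

/-- The predicate `A ⊗ I`: here `⟨w|A ⊗ I|w⟩ = ∑ j, ⟨w j|A|w j⟩` for `w = ∑ j, w j ⊗ |j⟩`. -/
def tensorId (A : InfPred m) : InfPred (m × n) where
  form w := ∑ j, A.form fun i => w (i, j)
  spectral := exists_spectral _
    (fun c w => by
      rw [Finset.mul_sum]
      exact Finset.sum_congr rfl fun j _ => A.form_smul c fun i => w (i, j))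
    (fun w z => by
      rw [← Finset.sum_add_distrib, Finset.mul_sum, Finset.mul_sum, ← Finset.sum_add_distrib]
      exact Finset.sum_congr rfl fun j _ =>
        A.form_parallelogram (fun i => w (i, j)) fun i => z (i, j))

/-- The predicate `I ⊗ A`. -/
def idTensor (A : InfPred n) : InfPred (m × n) where
  form w := ∑ i, A.form fun j => w (i, j)
  spectral := exists_spectral _
    (fun c w => by
      rw [Finset.mul_sum]
      exact Finset.sum_congr rfl fun i _ => A.form_smul c fun j => w (i, j))
    (fun w z => by
      rw [← Finset.sum_add_distrib, Finset.mul_sum, Finset.mul_sum, ← Finset.sum_add_distrib]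
      exact Finset.sum_congr rfl fun i _ =>
        A.form_parallelogram (fun j => w (i, j)) fun j => z (i, j))

/-- An orthonormal eigenbasis of `A` (as columns). -/
def eigUnitary (A : InfPred n) : Matrix n n ℂ := A.spectral.choose

/-- The eigenvalues of `A`. -/
def eigVal (A : InfPred n) : n → ℝ≥0∞ := A.spectral.choose_spec.choose

/-- The expectation `tr (A ρ) = ∑ i, lam i * ⟨b i|ρ|b i⟩` of `A` in a positive semidefinite `ρ`. -/
def expect (A : InfPred n) (ρ : Matrix n n ℂ) : ℝ≥0∞ :=
  ∑ i, A.eigVal i * ENNReal.ofReal ((A.eigUnitaryᴴ * ρ * A.eigUnitary) i i).re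

theorem sum_spectral_eq {m : Type*} [Fintype m] (A : InfPred n) (U : Matrix n n ℂ) (lam : n → ℝ≥0∞)
    (h : ∀ u, A.form u = ∑ i, lam i * ‖(Uᴴ *ᵥ u) i‖ₑ ^ 2) (C : Matrix m n ℂ) :
    ∑ i, lam i * ENNReal.ofReal ((Uᴴ * (Cᴴ * C) * U) i i).re = ∑ k, A.form (star (C k)) := by
  have key : ∀ i, ENNReal.ofReal ((Uᴴ * (Cᴴ * C) * U) i i).re
      = ∑ k, ‖(Uᴴ *ᵥ star (C k)) i‖ₑ ^ 2 := fun i => by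
    have e : Uᴴ * (Cᴴ * C) * U = (C * U)ᴴ * (C * U) := by
      simp only [Matrix.conjTranspose_mul, Matrix.mul_assoc]
    have e2 : ((C * U)ᴴ * (C * U)) i i = ((∑ k, ‖(C * U) k i‖ ^ 2 : ℝ) : ℂ) := by
      rw [Matrix.mul_apply]
      push_cast
      refine Finset.sum_congr rfl fun k _ => ?_
      rw [Matrix.conjTranspose_apply, Complex.star_def, Complex.conj_mul']
    rw [e, e2, Complex.ofReal_re, ENNReal.ofReal_sum_of_nonneg fun _ _ => by positivity]
    refine Finset.sum_congr rfl fun k _ => ?_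
    have e3 : (Uᴴ *ᵥ star (C k)) i = star ((C * U) k i) := by
      simp [Matrix.mulVec, dotProduct, Matrix.mul_apply, mul_comm]
    rw [e3, ← ofReal_norm, norm_star, ENNReal.ofReal_pow (norm_nonneg _)]
  simp only [h, key, Finset.mul_sum]
  exact Finset.sum_comm

/-- The expectation does not depend on the spectral decomposition. -/
theorem expect_eq_of_spectral (A : InfPred n) (U : Matrix n n ℂ) (lam : n → ℝ≥0∞)
    (h : ∀ u, A.form u = ∑ i, lam i * ‖(Uᴴ *ᵥ u) i‖ₑ ^ 2) {ρ : Matrix n n ℂ}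
    (hρ : ρ.PosSemidef) : A.expect ρ = ∑ i, lam i * ENNReal.ofReal ((Uᴴ * ρ * U) i i).re := by
  obtain ⟨C, rfl⟩ : ∃ C : Matrix n n ℂ, ρ = Cᴴ * C := by
    open scoped MatrixOrder Matrix.Norms.L2Operator in
    exact CStarAlgebra.nonneg_iff_eq_star_mul_self.1 (Matrix.nonneg_iff_posSemidef.2 hρ)
  rw [sum_spectral_eq A U lam h C]
  exact sum_spectral_eq A _ _ A.spectral.choose_spec.choose_spec C

open Classical in
/-- The guarded predicate `b | A`, which is `A` if `b` holds and `∞ • I` otherwise. -/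
def guard (b : Prop) (A : InfPred n) : InfPred n := if b then A else (⊤ : ℝ≥0∞) • 1

end InfPred

end InfPred

/-! ### Classical-quantum states, expectations and couplings -/

section States

variable {A A₁ A₂ n n₁ n₂ : Type*} [Fintype n] [DecidableEq n] [Fintype n₁] [DecidableEq n₁]
  [Fintype n₂] [DecidableEq n₂]

/-- Operator-valued functions. -/
abbrev CQFun (A n : Type*) : Type _ := A → Matrix n n ℂ

/-- The total trace (the probability mass) of a positive operator-valued function. -/
def totalTrace (Δ : CQFun A n) : ℝ≥0∞ := ∑' a, ENNReal.ofReal (Δ a).trace.re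

/-- Classical-quantum states: positive operator-valued functions of total trace at most `1`. -/
structure CQState (A n : Type*) [Fintype n] where
  val : CQFun A n
  psd : ∀ a, (val a).PosSemidef
  trace_le : totalTrace val ≤ 1

/-- The expected value of an infinite-valued assertion. -/
def expectation (Δ : CQFun A n) (φ : A → InfPred n) : ℝ≥0∞ := ∑' a, (φ a).expect (Δ a)

/-- The partial trace over the first factor. -/
def ptr₁ (ρ : Matrix (n₁ × n₂) (n₁ × n₂) ℂ) : Matrix n₂ n₂ ℂ :=
  Matrix.of fun j j' => ∑ i, ρ (i, j) (i, j')

/-- The partial trace over the second factor. -/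
def ptr₂ (ρ : Matrix (n₁ × n₂) (n₁ × n₂) ℂ) : Matrix n₁ n₁ ℂ :=
  Matrix.of fun i i' => ∑ j, ρ (i, j) (i', j)

/-- The second marginal; the sum converges for every state. -/
def marg₁ (Δ : CQFun (A₁ × A₂) (n₁ × n₂)) : CQFun A₂ n₂ := fun a₂ => ∑' a₁, ptr₁ (Δ (a₁, a₂))

/-- The first marginal; the sum converges for every state. -/
def marg₂ (Δ : CQFun (A₁ × A₂) (n₁ × n₂)) : CQFun A₁ n₁ := fun a₁ => ∑' a₂, ptr₂ (Δ (a₁, a₂))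

/-- `Δ` is a coupling of `Δ₁` and `Δ₂`. -/
def IsCoupling (Δ : CQState (A₁ × A₂) (n₁ × n₂)) (Δ₁ : CQFun A₁ n₁) (Δ₂ : CQFun A₂ n₂) : Prop :=
  marg₂ Δ.val = Δ₁ ∧ marg₁ Δ.val = Δ₂

/-- The restriction of `Δ` to the classical states that satisfy `b`. -/
def restrict (b : A → Bool) (Δ : CQFun A n) : CQFun A n := fun a => if b a then Δ a else 0

end States

/-! ### The programming language -/

section Language

/-- Classical states, for a set `C` of classical variables and a set `V` of values. -/
abbrev CState (C V : Type*) : Type _ := C → V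

/-- The computational basis of the space of all quantum variables; `D q` is the basis of `q`. -/
abbrev QIdx {Q : Type*} (D : Q → Type*) : Type _ := ∀ q, D q

/-- The computational basis of the space of a quantum register `S`. -/
abbrev RIdx {Q : Type*} (D : Q → Type*) (S : Finset Q) : Type _ := ∀ q : S, D q

/-- A measurement `{M v}` with outcomes in `V`, such that `∑ v, (M v)† (M v) = I`. -/
structure Measurement (V n : Type*) [Fintype n] [DecidableEq n] where
  op : V → Matrix n n ℂ
  complete : HasSum (fun v => (op v)ᴴ * op v) 1

/-- Commands over the classical variables `C` and the quantum variables `Q`. Expressions, guards and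
initial vectors are functions of the classical state. -/
inductive Cmd (C V : Type*) {Q : Type*} (D : Q → Type*) [Fintype Q] [DecidableEq Q]
    [∀ q, Fintype (D q)] [∀ q, DecidableEq (D q)] where
  | skip
  | abort
  | assign (x : C) (e : CState C V → V)
  | sample (x : C) (μ : PMF V)
  | init (S : Finset Q) (v : CState C V → {w : RIdx D S → ℂ // star w ⬝ᵥ w = 1})
  | apply (S : Finset Q) (U : Matrix.unitaryGroup (RIdx D S) ℂ)
  | meas (x : C) (S : Finset Q) (M : Measurement V (RIdx D S))
  | seq (c c' : Cmd C V D)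
  | ite (b : CState C V → Bool) (c c' : Cmd C V D)
  | loop (b : CState C V → Bool) (c : Cmd C V D)

variable {C V Q : Type*} {D : Q → Type*} [Fintype Q] [DecidableEq Q] [∀ q, Fintype (D q)]
  [∀ q, DecidableEq (D q)]

/-- The operator `A_S = A ⊗ I` on the whole space, for an operator `A` on the register `S`. -/
def embed (S : Finset Q) (A : Matrix (RIdx D S) (RIdx D S) ℂ) : Matrix (QIdx D) (QIdx D) ℂ :=
  Matrix.of fun s t => if ∀ q ∉ S, s q = t q then A (fun q => s q) (fun q => t q) else 0

/-- The operator `|v⟩⟨i|` of the register `S`, on the whole space. -/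
def initOp (S : Finset Q) (v : RIdx D S → ℂ) (i : RIdx D S) : Matrix (QIdx D) (QIdx D) ℂ :=
  embed S (Matrix.vecMulVec v (Pi.single i 1))

/-- `Eval(μ)(ρ)(v) = μ(v) ρ`. -/
def evalDist {n : Type*} (μ : PMF V) (ρ : Matrix n n ℂ) : CQFun V n :=
  fun v => ((μ v).toReal : ℂ) • ρ

/-- `Eval(M[S])(ρ)(v) = M_v ρ M_v†`. -/
def evalMeas (S : Finset Q) (M : Measurement V (RIdx D S)) (ρ : Matrix (QIdx D) (QIdx D) ℂ) :
    CQFun V (QIdx D) :=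
  fun v => embed S (M.op v) * ρ * (embed S (M.op v))ᴴ

section Semantics

variable [DecidableEq C]

open Classical in
/-- The state `∑ σ, ∑ v, ⟨σ[v/x], E (Δ σ) v⟩`. -/
def outcome {n : Type*} (x : C) (E : Matrix n n ℂ → CQFun V n) (Δ : CQFun (CState C V) n) :
    CQFun (CState C V) n :=
  fun τ => ∑' p : CState C V × V, if Function.update p.1 x p.2 = τ then E (Δ p.1) p.2 else 0

open Classical in
/-- The denotational semantics of commands. All sums converge when `Δ` is a state. -/
def sem : Cmd C V D → CQFun (CState C V) (QIdx D) → CQFun (CState C V) (QIdx D)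
  | .skip, Δ => Δ
  | .abort, _ => 0
  | .assign x e, Δ => fun τ => ∑' σ, if Function.update σ x (e σ) = τ then Δ σ else 0
  | .sample x μ, Δ => outcome x (evalDist μ) Δ
  | .init S v, Δ => fun σ => ∑ i, initOp S (v σ).1 i * Δ σ * (initOp S (v σ).1 i)ᴴ
  | .apply S U, Δ => fun σ => embed S (U : Matrix _ _ ℂ) * Δ σ * (embed S (U : Matrix _ _ ℂ))ᴴ
  | .meas x S M, Δ => outcome x (evalMeas S M) Δ
  | .seq c c', Δ => sem c' (sem c Δ)
  | .ite b c c', Δ => sem c (restrict b Δ) + sem c' (restrict (fun σ => !b σ) Δ)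
  | .loop b c, Δ => fun τ =>
      ∑' k : ℕ, restrict (fun σ => !b σ) ((fun Γ => sem c (restrict b Γ))^[k] Δ) τ

/-- Almost sure termination: the output has the same trace as the input, for every input state. -/
def AST (c : Cmd C V D) : Prop :=
  ∀ Δ : CQState (CState C V) (QIdx D), totalTrace (sem c Δ.val) = totalTrace Δ.val

/-- Hereditary almost sure termination: the command and all its subcommands are `AST`. -/
def HAST : Cmd C V D → Prop
  | .seq c c' => AST (.seq c c') ∧ HAST c ∧ HAST c'
  | .ite b c c' => AST (.ite b c c') ∧ HAST c ∧ HAST c'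
  | .loop b c => AST (.loop b c) ∧ HAST c
  | c => AST c

end Semantics

/-- The classical variables on the left of an assignment, a sampling or a measurement. -/
def modified : Cmd C V D → Set C
  | .assign x _ => {x}
  | .sample x _ => {x}
  | .meas x _ _ => {x}
  | .seq c c' => modified c ∪ modified c'
  | .ite _ c c' => modified c ∪ modified c'
  | .loop _ c => modified c
  | _ => ∅

end Language

/-! ### The program logic -/

section Logic

open scoped Kronecker

/-- Infinite-valued unary assertions. -/
abbrev Assn (C V : Type*) {Q : Type*} (D : Q → Type*) [Fintype Q] [DecidableEq Q]
    [∀ q, Fintype (D q)] [∀ q, DecidableEq (D q)] : Type _ :=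
  CState C V → InfPred (QIdx D)

/-- Bounded assertions: `‖φ σ‖ ≤ L` for all `σ`, with a finite constant `L`. -/
def BoundedAssn {A n : Type*} [Fintype n] [DecidableEq n] (φ : A → InfPred n) : Prop :=
  ∃ L : ℝ≥0, ∀ a, φ a ≤ (L : ℝ≥0∞) • 1

variable {C₁ C₂ V Q₁ Q₂ : Type*} {D₁ : Q₁ → Type*} {D₂ : Q₂ → Type*}
  [DecidableEq C₁] [DecidableEq C₂]
  [Fintype Q₁] [DecidableEq Q₁] [∀ q, Fintype (D₁ q)] [∀ q, DecidableEq (D₁ q)]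
  [Fintype Q₂] [DecidableEq Q₂] [∀ q, Fintype (D₂ q)] [∀ q, DecidableEq (D₂ q)]

/-- Infinite-valued relational assertions. -/
abbrev RAssn (C₁ C₂ V : Type*) {Q₁ Q₂ : Type*} (D₁ : Q₁ → Type*) (D₂ : Q₂ → Type*)
    [Fintype Q₁] [DecidableEq Q₁] [∀ q, Fintype (D₁ q)] [∀ q, DecidableEq (D₁ q)]
    [Fintype Q₂] [DecidableEq Q₂] [∀ q, Fintype (D₂ q)] [∀ q, DecidableEq (D₂ q)] : Type _ :=
  CState C₁ V × CState C₂ V → InfPred (QIdx D₁ × QIdx D₂)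

/-- Relational classical-quantum states. -/
abbrev RState (C₁ C₂ V : Type*) {Q₁ Q₂ : Type*} (D₁ : Q₁ → Type*) (D₂ : Q₂ → Type*)
    [Fintype Q₁] [DecidableEq Q₁] [∀ q, Fintype (D₁ q)] [∀ q, DecidableEq (D₁ q)]
    [Fintype Q₂] [DecidableEq Q₂] [∀ q, Fintype (D₂ q)] [∀ q, DecidableEq (D₂ q)] : Type _ :=
  CQState (CState C₁ V × CState C₂ V) (QIdx D₁ × QIdx D₂)

/-- The split assertion `φ₁ ⊗ id + id ⊗ φ₂`. -/
def split (φ₁ : Assn C₁ V D₁) (φ₂ : Assn C₂ V D₂) : RAssn C₁ C₂ V D₁ D₂ :=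
  fun σ => (φ₁ σ.1).tensorId + (φ₂ σ.2).idTensor

/-- The assertion `φ + n • id`. -/
def addConst (φ : RAssn C₁ C₂ V D₁ D₂) (n : ℕ) : RAssn C₁ C₂ V D₁ D₂ :=
  fun σ => φ σ + (n : ℝ≥0∞) • 1

/-- The guarded assertion `b | φ`. -/
def guarded (b : CState C₁ V × CState C₂ V → Prop) (φ : RAssn C₁ C₂ V D₁ D₂) :
    RAssn C₁ C₂ V D₁ D₂ :=
  fun σ => (φ σ).guard (b σ)

/-- The classical state `(σ₁[v/x], σ₂)`. -/
def updL (σ : CState C₁ V × CState C₂ V) (x : C₁) (v : V) : CState C₁ V × CState C₂ V :=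
  (Function.update σ.1 x v, σ.2)

/-- The classical state `(σ₁, σ₂[v/x])`. -/
def updR (σ : CState C₁ V × CState C₂ V) (x : C₂) (v : V) : CState C₁ V × CState C₂ V :=
  (σ.1, Function.update σ.2 x v)

/-- The predicate `K† A K` for an operator `K` on the left system. -/
def conjL (K : Matrix (QIdx D₁) (QIdx D₁) ℂ) (A : InfPred (QIdx D₁ × QIdx D₂)) :
    InfPred (QIdx D₁ × QIdx D₂) :=
  A.conj (K ⊗ₖ (1 : Matrix (QIdx D₂) (QIdx D₂) ℂ))

/-- The predicate `K† A K` for an operator `K` on the right system. -/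
def conjR (K : Matrix (QIdx D₂) (QIdx D₂) ℂ) (A : InfPred (QIdx D₁ × QIdx D₂)) :
    InfPred (QIdx D₁ × QIdx D₂) :=
  A.conj ((1 : Matrix (QIdx D₁) (QIdx D₁) ℂ) ⊗ₖ K)

/-- Validity of the judgment `{ψ} c₁ ∼ c₂ {φ}`. -/
def Valid (ψ : RAssn C₁ C₂ V D₁ D₂) (c₁ : Cmd C₁ V D₁) (c₂ : Cmd C₂ V D₂)
    (φ : RAssn C₁ C₂ V D₁ D₂) : Prop :=
  ∀ Δ : RState C₁ C₂ V D₁ D₂, ∃ Δ' : RState C₁ C₂ V D₁ D₂,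
    IsCoupling Δ' (sem c₁ (marg₂ Δ.val)) (sem c₂ (marg₁ Δ.val)) ∧
      expectation Δ'.val φ ≤ expectation Δ.val ψ

/-- The coupling condition `g₁ ≈ g₂ : ψ ⇒ Φ`. -/
def CouplingCond (g₁ : Matrix (QIdx D₁) (QIdx D₁) ℂ → CQFun V (QIdx D₁))
    (g₂ : Matrix (QIdx D₂) (QIdx D₂) ℂ → CQFun V (QIdx D₂))
    (ψ : RAssn C₁ C₂ V D₁ D₂) (Φ : V × V → RAssn C₁ C₂ V D₁ D₂) : Prop :=
  ∀ (σ : CState C₁ V × CState C₂ V) (ρ : Matrix (QIdx D₁ × QIdx D₂) (QIdx D₁ × QIdx D₂) ℂ),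
    ρ.PosSemidef → ρ.trace.re ≤ 1 →
      ∃ Δ : CQState (V × V) (QIdx D₁ × QIdx D₂), IsCoupling Δ (g₁ (ptr₂ ρ)) (g₂ (ptr₁ ρ)) ∧
        expectation Δ.val (fun p => Φ p σ) ≤ (ψ σ).expect ρ

/-- The infimum of the expectation of `φ` over all couplings of `Δ₁` and `Δ₂`
(it is `∞` if there is no coupling). -/
def infCoupling (Δ₁ : CQFun (CState C₁ V) (QIdx D₁)) (Δ₂ : CQFun (CState C₂ V) (QIdx D₂))
    (φ : RAssn C₁ C₂ V D₁ D₂) : ℝ≥0∞ :=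
  ⨅ (Δ' : RState C₁ C₂ V D₁ D₂) (_ : IsCoupling Δ' Δ₁ Δ₂), expectation Δ'.val φ

/-- The duality set of `φ`: the triples `(n, φ₁, φ₂)` with `φ₁`, `φ₂` bounded and
`φ₁ ⊗ id + id ⊗ φ₂ ⊑ φ + n • id`. -/
def dualitySet (φ : RAssn C₁ C₂ V D₁ D₂) : Set (ℕ × Assn C₁ V D₁ × Assn C₂ V D₂) :=
  {t | BoundedAssn t.2.1 ∧ BoundedAssn t.2.2 ∧ ∀ σ, split t.2.1 t.2.2 σ ≤ addConst φ t.1 σ}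

/-- Derivability of judgments `{ψ} c₁ ∼ c₂ {φ}`. The last four rules express that commands are
identified up to `skip; c = c = c; skip`. -/
inductive Derivable : RAssn C₁ C₂ V D₁ D₂ → Cmd C₁ V D₁ → Cmd C₂ V D₂ →
    RAssn C₁ C₂ V D₁ D₂ → Prop
  -- one-sided rules, left
  | assignL (x e ψ) : Derivable (fun σ => ψ (updL σ x (e σ.1))) (.assign x e) .skip ψ
  | ifL (b c c' c₂ ψ φ) :
      Derivable (guarded (fun σ => b σ.1 = true) ψ) c c₂ φ →
      Derivable (guarded (fun σ => b σ.1 = false) ψ) c' c₂ φ →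
      Derivable ψ (.ite b c c') c₂ φ
  | whileL (b c ψ) :
      Derivable (guarded (fun σ => b σ.1 = true) ψ) c .skip ψ → AST (.loop b c) →
      Derivable ψ (.loop b c) .skip (guarded (fun σ => b σ.1 = false) ψ)
  | sampleL (x) (μ : PMF V) (ψ) :
      Derivable (fun σ => .sum fun v => μ v • ψ (updL σ x v)) (.sample x μ) .skip ψ
  | initL (S v ψ) :
      Derivable (fun σ => .sum fun i => conjL (initOp S (v σ.1).1 i) (ψ σ)) (.init S v) .skip ψ
  | applyL (S) (U : Matrix.unitaryGroup (RIdx D₁ S) ℂ) (ψ) :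
      Derivable (fun σ => conjL (embed S (U : Matrix _ _ ℂ)) (ψ σ)) (.apply S U) .skip ψ
  | measL (x S) (M : Measurement V (RIdx D₁ S)) (ψ) :
      Derivable (fun σ => .sum fun v => conjL (embed S (M.op v)) (ψ (updL σ x v)))
        (.meas x S M) .skip ψ
  -- one-sided rules, right
  | assignR (x e ψ) : Derivable (fun σ => ψ (updR σ x (e σ.2))) .skip (.assign x e) ψ
  | ifR (b c₁ c c' ψ φ) :
      Derivable (guarded (fun σ => b σ.2 = true) ψ) c₁ c φ →
      Derivable (guarded (fun σ => b σ.2 = false) ψ) c₁ c' φ →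
      Derivable ψ c₁ (.ite b c c') φ
  | whileR (b c ψ) :
      Derivable (guarded (fun σ => b σ.2 = true) ψ) .skip c ψ → AST (.loop b c) →
      Derivable ψ .skip (.loop b c) (guarded (fun σ => b σ.2 = false) ψ)
  | sampleR (x) (μ : PMF V) (ψ) :
      Derivable (fun σ => .sum fun v => μ v • ψ (updR σ x v)) .skip (.sample x μ) ψ
  | initR (S v ψ) :
      Derivable (fun σ => .sum fun i => conjR (initOp S (v σ.2).1 i) (ψ σ)) .skip (.init S v) ψ
  | applyR (S) (U : Matrix.unitaryGroup (RIdx D₂ S) ℂ) (ψ) :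
      Derivable (fun σ => conjR (embed S (U : Matrix _ _ ℂ)) (ψ σ)) .skip (.apply S U) ψ
  | measR (x S) (M : Measurement V (RIdx D₂ S)) (ψ) :
      Derivable (fun σ => .sum fun v => conjR (embed S (M.op v)) (ψ (updR σ x v)))
        .skip (.meas x S M) ψ
  -- two-sided rules
  | skip (ψ) : Derivable ψ .skip .skip ψ
  | assign (x₁ e₁ x₂ e₂ ψ) :
      Derivable (fun σ => ψ (updR (updL σ x₁ (e₁ σ.1)) x₂ (e₂ σ.2)))
        (.assign x₁ e₁) (.assign x₂ e₂) ψ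
  | seq (c₁ c₁' c₂ c₂' ψ ξ φ) :
      Derivable ψ c₁ c₂ ξ → Derivable ξ c₁' c₂' φ →
      Derivable ψ (.seq c₁ c₁') (.seq c₂ c₂') φ
  | ite (b₁ c₁ c₁' b₂ c₂ c₂' ψ φ) :
      Derivable (guarded (fun σ => b₁ σ.1 = true ∧ b₂ σ.2 = true) ψ) c₁ c₂ φ →
      Derivable (guarded (fun σ => b₁ σ.1 = false ∧ b₂ σ.2 = false) ψ) c₁' c₂' φ →
      Derivable (guarded (fun σ => b₁ σ.1 = b₂ σ.2) ψ) (.ite b₁ c₁ c₁') (.ite b₂ c₂ c₂') φ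
  | loop (b₁ c₁ b₂ c₂ ψ) :
      Derivable (guarded (fun σ => b₁ σ.1 = true ∧ b₂ σ.2 = true) ψ) c₁ c₂
        (guarded (fun σ => b₁ σ.1 = b₂ σ.2) ψ) →
      Derivable (guarded (fun σ => b₁ σ.1 = b₂ σ.2) ψ) (.loop b₁ c₁) (.loop b₂ c₂)
        (guarded (fun σ => b₁ σ.1 = false ∧ b₂ σ.2 = false) ψ)
  | sample (x₁ μ₁ x₂ μ₂ ψ φ) :
      CouplingCond (evalDist μ₁) (evalDist μ₂) ψ
        (fun p σ => φ (updR (updL σ x₁ p.1) x₂ p.2)) →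
      Derivable ψ (.sample x₁ μ₁) (.sample x₂ μ₂) φ
  | meas (x₁ S₁ M₁ x₂ S₂ M₂ ψ φ) :
      CouplingCond (evalMeas S₁ M₁) (evalMeas S₂ M₂) ψ
        (fun p σ => φ (updR (updL σ x₁ p.1) x₂ p.2)) →
      Derivable ψ (.meas x₁ S₁ M₁) (.meas x₂ S₂ M₂) φ
  | measSample (x₁ S₁ M₁ x₂ μ₂ ψ φ) :
      CouplingCond (evalMeas S₁ M₁) (evalDist μ₂) ψ
        (fun p σ => φ (updR (updL σ x₁ p.1) x₂ p.2)) →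
      Derivable ψ (.meas x₁ S₁ M₁) (.sample x₂ μ₂) φ
  -- structural rules
  | conseq (c₁ c₂ ψ ψ' φ φ') :
      Derivable ψ' c₁ c₂ φ' →
      (∀ (Δ : RState C₁ C₂ V D₁ D₂) (Δ₁ : CQState (CState C₁ V) (QIdx D₁))
        (Δ₂ : CQState (CState C₂ V) (QIdx D₂)),
        infCoupling Δ₁.val Δ₂.val φ' ≤ expectation Δ.val ψ' →
        infCoupling Δ₁.val Δ₂.val φ ≤ expectation Δ.val ψ) →
      Derivable ψ c₁ c₂ φ
  | nmod (x c₁ c₂ ψ φ) :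
      x ∉ modified c₁ →
      (∀ v, Derivable (guarded (fun σ => σ.1 x = v) ψ) c₁ c₂ (fun σ => φ (updL σ x v))) →
      Derivable ψ c₁ c₂ φ
  | duality (c₁ c₂ ψ φ) :
      AST c₁ → AST c₂ →
      (∀ t ∈ dualitySet φ, Derivable (addConst ψ t.1) c₁ c₂ (split t.2.1 t.2.2)) →
      Derivable ψ c₁ c₂ φ
  | limit (c₁ c₂ ψ) (φs : ℕ → RAssn C₁ C₂ V D₁ D₂) (φ) :
      (∀ k, Derivable ψ c₁ c₂ (φs k)) →
      (∀ k σ, φs k σ ≤ φs (k + 1) σ) →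
      (∀ σ u, Filter.Tendsto (fun k => (φs k σ).form u) Filter.atTop (𝓝 ((φ σ).form u))) →
      Derivable ψ c₁ c₂ φ
  -- units of sequential composition
  | skipSeqL (c₁ c₂ ψ φ) : Derivable ψ (.seq .skip c₁) c₂ φ → Derivable ψ c₁ c₂ φ
  | seqSkipL (c₁ c₂ ψ φ) : Derivable ψ (.seq c₁ .skip) c₂ φ → Derivable ψ c₁ c₂ φ
  | skipSeqR (c₁ c₂ ψ φ) : Derivable ψ c₁ (.seq .skip c₂) φ → Derivable ψ c₁ c₂ φ
  | seqSkipR (c₁ c₂ ψ φ) : Derivable ψ c₁ (.seq c₂ .skip) φ → Derivable ψ c₁ c₂ φ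

end Logic

end CqOTL

end

/-!
Completeness only needs the easy direction of optimal transport duality. By the duality rule it is
enough to derive `{ψ + k} c₁ ∼ c₂ {φ₁ ⊗ I + I ⊗ φ₂}` for the split assertions below `φ + k`.

A split postcondition separates the two programs. Every command has a weakest precondition `wp c φ`,
an infinite-valued assertion that computes expectations: `expectation (sem c Δ) φ` equals
`expectation Δ (wp c φ)` (`adequate_wp`). The one-sided rules derive `wp c₁ φ₁ ⊗ I + I ⊗ φ₂` as a
precondition of `c₁ ∼ skip`, and symmetrically on the right (`derivable_wp_left`,
`derivable_wp_right`). This is where hereditary termination enters: it excludes `abort`, and it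
allows the loop rule, with the weakest precondition of the loop as invariant. The other tensor
factor is undisturbed, because sampling, initialization, unitaries and measurements are Kraus
families `K` with `∑ i, (K i)† (K i) = 1` (`sum_conjL_split`, `sum_smul_split_left`). Sequencing the
two sides gives `derivable_wp`.

Finally, the precondition `wp c₁ φ₁ ⊗ I + I ⊗ wp c₂ φ₂` has expectation at most that of `ψ + k` in
every relational state `Δ` (`Valid.expectation_wp_le`). A coupling `Δ'` provided by validity has the
outputs as marginals, so the expectation of the precondition in `Δ` is the expectation of
`φ₁ ⊗ I + I ⊗ φ₂` in `Δ'`; this is at most the expectation of `φ + k` in `Δ'`, hence at most that of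
`ψ + k` in `Δ`, as the semantics does not increase the trace. The consequence rule concludes.
-/

open scoped ENNReal NNReal Matrix ComplexOrder Topology
noncomputable section
namespace CqOTL

/-! ### Positive semidefinite matrices and partial traces -/

section Matrices

variable {m n n₁ n₂ ι : Type*}

theorem _root_.Matrix.PosSemidef.exists_conjTranspose_mul [Fintype n] [DecidableEq n]
    {ρ : Matrix n n ℂ} (h : ρ.PosSemidef) :
    ∃ C : Matrix n n ℂ, ρ = Cᴴ * C := by
  open scoped MatrixOrder Matrix.Norms.L2Operator in
  exact CStarAlgebra.nonneg_iff_eq_star_mul_self.1 (Matrix.nonneg_iff_posSemidef.2 h)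

/-- A factorization of the partial trace over the second factor. -/
theorem ptr₂_conjTranspose_mul [Fintype m] [Fintype n₂] (C : Matrix m (n₁ × n₂) ℂ) :
    ptr₂ (Cᴴ * C) = (Matrix.of fun (p : m × n₂) i => C p.1 (i, p.2))ᴴ *
      (Matrix.of fun (p : m × n₂) i => C p.1 (i, p.2)) := by
  ext i i'
  simp only [ptr₂, Matrix.of_apply, Matrix.mul_apply, Matrix.conjTranspose_apply]
  rw [Finset.sum_comm, ← Finset.sum_product']
  rfl

/-- A factorization of the partial trace over the first factor. -/
theorem ptr₁_conjTranspose_mul [Fintype m] [Fintype n₁] (C : Matrix m (n₁ × n₂) ℂ) :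
    ptr₁ (Cᴴ * C) = (Matrix.of fun (p : m × n₁) j => C p.1 (p.2, j))ᴴ *
      (Matrix.of fun (p : m × n₁) j => C p.1 (p.2, j)) := by
  ext i i'
  simp only [ptr₁, Matrix.of_apply, Matrix.mul_apply, Matrix.conjTranspose_apply]
  rw [Finset.sum_comm, ← Finset.sum_product']
  rfl

theorem trace_ptr₂ [Fintype n₁] [Fintype n₂] (ρ : Matrix (n₁ × n₂) (n₁ × n₂) ℂ) :
    (ptr₂ ρ).trace = ρ.trace := by
  simp only [Matrix.trace, Matrix.diag, ptr₂, Matrix.of_apply, Fintype.sum_prod_type]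

theorem trace_ptr₁ [Fintype n₁] [Fintype n₂] (ρ : Matrix (n₁ × n₂) (n₁ × n₂) ℂ) :
    (ptr₁ ρ).trace = ρ.trace := by
  simp only [Matrix.trace, Matrix.diag, ptr₁, Matrix.of_apply, Fintype.sum_prod_type_right]

theorem trace_re_nonneg [Fintype n] {ρ : Matrix n n ℂ} (hρ : ρ.PosSemidef) : 0 ≤ ρ.trace.re :=
  (Complex.le_def.1 hρ.trace_nonneg).1

theorem posSemidef_of_hasSum [Fintype n] {f : ι → Matrix n n ℂ} (hf : ∀ i, (f i).PosSemidef)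
    {ρ : Matrix n n ℂ} (h : HasSum f ρ) : ρ.PosSemidef := by
  refine Matrix.PosSemidef.of_dotProduct_mulVec_nonneg ?_ fun u => ?_
  · have h1 := h.matrix_conjTranspose
    simp only [fun i => (hf i).isHermitian.eq] at h1
    exact h1.unique h
  · have hc : Continuous fun M : Matrix n n ℂ => star u ⬝ᵥ (M *ᵥ u) := by fun_prop
    have h2 := h.map (AddMonoidHom.mk' (fun M : Matrix n n ℂ => star u ⬝ᵥ (M *ᵥ u))
      fun M N => by rw [Matrix.add_mulVec, dotProduct_add]) hc
    exact h2.nonneg fun i => (hf i).dotProduct_mulVec_nonneg u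

theorem posSemidef_tsum [Fintype n] {f : ι → Matrix n n ℂ} (hf : ∀ i, (f i).PosSemidef) :
    (∑' i, f i).PosSemidef := by
  by_cases h : Summable f
  · exact posSemidef_of_hasSum hf h.hasSum
  · rw [tsum_eq_zero_of_not_summable h]
    exact Matrix.PosSemidef.zero

end Matrices

/-! ### Expectations of infinite-valued predicates -/

section Expect

variable {m n n₁ n₂ ι : Type*} [Fintype n] [DecidableEq n]
  [Fintype n₁] [DecidableEq n₁] [Fintype n₂] [DecidableEq n₂]

namespace InfPred

/-- The expectation in `ρ = ∑ k, |star (C k)⟩⟨star (C k)|` is the sum of the values of the quadratic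
form: this reduces identities between expectations to identities between forms. -/
theorem expect_conjTranspose_mul [Fintype m] (A : InfPred n) (C : Matrix m n ℂ) :
    A.expect (Cᴴ * C) = ∑ k, A.form (star (C k)) :=
  sum_spectral_eq A _ _ A.spectral.choose_spec.choose_spec C

theorem expect_zero (A : InfPred n) : A.expect 0 = 0 := by
  simp [expect]

theorem expect_add_right (A : InfPred n) {ρ ρ' : Matrix n n ℂ} (hρ : ρ.PosSemidef)
    (hρ' : ρ'.PosSemidef) : A.expect (ρ + ρ') = A.expect ρ + A.expect ρ' := by
  simp only [expect, ← Finset.sum_add_distrib, ← mul_add]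
  refine Finset.sum_congr rfl fun i _ => ?_
  rw [Matrix.mul_add, Matrix.add_mul, Matrix.add_apply, Complex.add_re, ENNReal.ofReal_add]
  exacts [(Complex.le_def.1 (hρ.conjTranspose_mul_mul_same _).diag_nonneg).1,
    (Complex.le_def.1 (hρ'.conjTranspose_mul_mul_same _).diag_nonneg).1]

theorem expect_smul_right (A : InfPred n) {r : ℝ} (hr : 0 ≤ r) (ρ : Matrix n n ℂ) :
    A.expect ((r : ℂ) • ρ) = ENNReal.ofReal r * A.expect ρ := by
  simp only [expect, Finset.mul_sum]
  refine Finset.sum_congr rfl fun i _ => ?_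
  rw [Matrix.mul_smul, Matrix.smul_mul, Matrix.smul_apply, smul_eq_mul, Complex.re_ofReal_mul,
    ENNReal.ofReal_mul hr]
  ring

theorem form_zero_smul (A : InfPred n) (u : n → ℂ) : ((0 : ℝ≥0∞) • A).form u = 0 :=
  zero_mul (A.form u)

theorem expect_mono {A B : InfPred n} (h : A ≤ B) {ρ : Matrix n n ℂ} (hρ : ρ.PosSemidef) :
    A.expect ρ ≤ B.expect ρ := by
  obtain ⟨C, rfl⟩ := hρ.exists_conjTranspose_mul
  simp only [expect_conjTranspose_mul]
  exact Finset.sum_le_sum fun k _ => h _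

theorem expect_add (A B : InfPred n) {ρ : Matrix n n ℂ} (hρ : ρ.PosSemidef) :
    (A + B).expect ρ = A.expect ρ + B.expect ρ := by
  obtain ⟨C, rfl⟩ := hρ.exists_conjTranspose_mul
  simp only [expect_conjTranspose_mul, ← Finset.sum_add_distrib]
  rfl

theorem expect_smul (r : ℝ≥0∞) (A : InfPred n) {ρ : Matrix n n ℂ} (hρ : ρ.PosSemidef) :
    (r • A).expect ρ = r * A.expect ρ := by
  obtain ⟨C, rfl⟩ := hρ.exists_conjTranspose_mul
  simp only [expect_conjTranspose_mul, Finset.mul_sum]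
  rfl

theorem expect_sum (A : ι → InfPred n) {ρ : Matrix n n ℂ} (hρ : ρ.PosSemidef) :
    (InfPred.sum A).expect ρ = ∑' i, (A i).expect ρ := by
  obtain ⟨C, rfl⟩ := hρ.exists_conjTranspose_mul
  simp only [expect_conjTranspose_mul]
  exact (Summable.tsum_finsetSum fun _ _ => ENNReal.summable).symm

theorem expect_conj [Fintype m] [DecidableEq m] (K : Matrix m n ℂ) (A : InfPred m)
    {ρ : Matrix n n ℂ} (hρ : ρ.PosSemidef) :
    (A.conj K).expect ρ = A.expect (K * ρ * Kᴴ) := by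
  obtain ⟨C, rfl⟩ := hρ.exists_conjTranspose_mul
  have e : K * (Cᴴ * C) * Kᴴ = (C * Kᴴ)ᴴ * (C * Kᴴ) := by
    simp only [Matrix.conjTranspose_mul, Matrix.conjTranspose_conjTranspose, Matrix.mul_assoc]
  rw [e, expect_conjTranspose_mul, expect_conjTranspose_mul]
  refine Finset.sum_congr rfl fun k _ => ?_
  change A.form (K *ᵥ star (C k)) = _
  congr 1
  ext i
  simp [Matrix.mulVec, dotProduct, Matrix.mul_apply, mul_comm]

theorem expect_one {ρ : Matrix n n ℂ} (hρ : ρ.PosSemidef) :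
    (1 : InfPred n).expect ρ = ENNReal.ofReal ρ.trace.re := by
  rw [expect_eq_of_spectral 1 1 (fun _ => 1) (fun u => by simp; rfl) hρ]
  simp only [Matrix.conjTranspose_one, one_mul, mul_one, Matrix.trace, Matrix.diag, Complex.re_sum]
  rw [ENNReal.ofReal_sum_of_nonneg fun i _ => (Complex.le_def.1 hρ.diag_nonneg).1]

theorem expect_tensorId (A : InfPred n₁) {ρ : Matrix (n₁ × n₂) (n₁ × n₂) ℂ} (hρ : ρ.PosSemidef) :
    (A.tensorId (n := n₂)).expect ρ = A.expect (ptr₂ ρ) := by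
  obtain ⟨C, rfl⟩ := hρ.exists_conjTranspose_mul
  rw [ptr₂_conjTranspose_mul, expect_conjTranspose_mul, expect_conjTranspose_mul]
  symm
  rw [Fintype.sum_prod_type]
  rfl

theorem expect_idTensor (A : InfPred n₂) {ρ : Matrix (n₁ × n₂) (n₁ × n₂) ℂ} (hρ : ρ.PosSemidef) :
    (A.idTensor (m := n₁)).expect ρ = A.expect (ptr₁ ρ) := by
  obtain ⟨C, rfl⟩ := hρ.exists_conjTranspose_mul
  rw [ptr₁_conjTranspose_mul, expect_conjTranspose_mul, expect_conjTranspose_mul]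
  symm
  rw [Fintype.sum_prod_type]
  rfl

end InfPred

theorem posSemidef_ptr₂ {ρ : Matrix (n₁ × n₂) (n₁ × n₂) ℂ} (hρ : ρ.PosSemidef) :
    (ptr₂ ρ).PosSemidef := by
  obtain ⟨C, rfl⟩ := hρ.exists_conjTranspose_mul
  rw [ptr₂_conjTranspose_mul]
  exact Matrix.posSemidef_conjTranspose_mul_self _

theorem posSemidef_ptr₁ {ρ : Matrix (n₁ × n₂) (n₁ × n₂) ℂ} (hρ : ρ.PosSemidef) :
    (ptr₁ ρ).PosSemidef := by
  obtain ⟨C, rfl⟩ := hρ.exists_conjTranspose_mul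
  rw [ptr₁_conjTranspose_mul]
  exact Matrix.posSemidef_conjTranspose_mul_self _

/-! ### Infinite sums of positive semidefinite matrices -/

/-- This bound reduces summability of positive matrices to that of their traces. -/
theorem norm_apply_le_trace {ρ : Matrix n n ℂ} (hρ : ρ.PosSemidef) (i j : n) :
    ‖ρ i j‖ ≤ ρ.trace.re := by
  obtain ⟨C, rfl⟩ := hρ.exists_conjTranspose_mul
  have ht : (Cᴴ * C).trace.re = ∑ k, ∑ l, ‖C k l‖ ^ 2 := by
    rw [Finset.sum_comm, Matrix.trace, Complex.re_sum]
    refine Finset.sum_congr rfl fun l _ => ?_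
    rw [Matrix.diag_apply, Matrix.mul_apply, Complex.re_sum]
    refine Finset.sum_congr rfl fun k _ => ?_
    rw [Matrix.conjTranspose_apply, Complex.star_def, Complex.conj_mul', ← Complex.ofReal_pow,
      Complex.ofReal_re]
  rw [ht, Matrix.mul_apply]
  refine (norm_sum_le _ _).trans (Finset.sum_le_sum fun k _ => ?_)
  have h : ∀ l, ‖C k l‖ ^ 2 ≤ ∑ l, ‖C k l‖ ^ 2 := fun l =>
    Finset.single_le_sum (f := fun l => ‖C k l‖ ^ 2) (fun _ _ => by positivity) (Finset.mem_univ l)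
  rw [Matrix.conjTranspose_apply, norm_mul, norm_star]
  nlinarith [h i, h j, sq_nonneg (‖C k i‖ - ‖C k j‖)]

theorem summable_of_trace {f : ι → Matrix n n ℂ} (hf : ∀ i, (f i).PosSemidef)
    (ht : ∑' i, ENNReal.ofReal (f i).trace.re ≠ ⊤) : Summable f := by
  refine Pi.summable.2 fun i => Pi.summable.2 fun j => ?_
  refine Summable.of_norm_bounded (ENNReal.summable_toReal ht) fun k => ?_
  rw [ENNReal.toReal_ofReal (trace_re_nonneg (hf k))]
  exact norm_apply_le_trace (hf k) i j

/-- Expectations are countably additive in the operator. -/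
theorem InfPred.expect_tsum (A : InfPred n) {f : ι → Matrix n n ℂ} (hf : ∀ i, (f i).PosSemidef)
    (hs : Summable f) : A.expect (∑' i, f i) = ∑' i, A.expect (f i) := by
  simp only [InfPred.expect]
  rw [Summable.tsum_finsetSum fun _ _ => ENNReal.summable]
  refine Finset.sum_congr rfl fun j _ => ?_
  rw [ENNReal.tsum_mul_left]
  congr 1
  let L : Matrix n n ℂ →+ ℝ := AddMonoidHom.mk'
    (fun M => ((A.eigUnitaryᴴ * M * A.eigUnitary) j j).re)
    fun M N => by rw [Matrix.mul_add, Matrix.add_mul, Matrix.add_apply, Complex.add_re]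
  have hc : Continuous L := by
    refine Complex.continuous_re.comp ?_
    exact Continuous.matrix_elem (by fun_prop) j j
  have h2 := hs.hasSum.map L hc
  change ENNReal.ofReal (L _) = _
  rw [← h2.tsum_eq]
  refine ENNReal.ofReal_tsum_of_nonneg (fun i => ?_) h2.summable
  exact (Complex.le_def.1 ((hf i).conjTranspose_mul_mul_same _).diag_nonneg).1

end Expect

/-! ### Positive operator-valued functions -/

section Functions

variable {A A₁ A₂ n n₁ n₂ ι : Type*} [Fintype n] [DecidableEq n] [Fintype n₁] [DecidableEq n₁]
  [Fintype n₂] [DecidableEq n₂]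

theorem totalTrace_eq_expectation {Δ : CQFun A n} (h : ∀ a, (Δ a).PosSemidef) :
    totalTrace Δ = expectation Δ fun _ => 1 :=
  tsum_congr fun a => (InfPred.expect_one (h a)).symm

theorem expectation_mono {Δ : CQFun A n} (h : ∀ a, (Δ a).PosSemidef) {φ φ' : A → InfPred n}
    (hφ : ∀ a, φ a ≤ φ' a) : expectation Δ φ ≤ expectation Δ φ' :=
  ENNReal.tsum_le_tsum fun a => InfPred.expect_mono (hφ a) (h a)

theorem expectation_add {Δ : CQFun A n} (h : ∀ a, (Δ a).PosSemidef) (φ φ' : A → InfPred n) :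
    (expectation Δ fun a => φ a + φ' a) = expectation Δ φ + expectation Δ φ' := by
  simp only [expectation, fun a => InfPred.expect_add (φ a) (φ' a) (h a)]
  exact ENNReal.tsum_add

theorem expectation_sum {Δ : CQFun A n} (h : ∀ a, (Δ a).PosSemidef) (φ : ι → A → InfPred n) :
    (expectation Δ fun a => .sum fun i => φ i a) = ∑' i, expectation Δ (φ i) := by
  simp only [expectation, fun a => InfPred.expect_sum (fun i => φ i a) (h a)]
  exact ENNReal.tsum_comm

open Classical in
/-- The sum `∑ i, ⟨G i, f i⟩` of point states. -/
def pushforward (G : ι → A) (f : ι → Matrix n n ℂ) : CQFun A n :=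
  fun a => ∑' i, if G i = a then f i else 0

theorem posSemidef_pushforward {n : Type*} [Fintype n] {G : ι → A} {f : ι → Matrix n n ℂ}
    (hf : ∀ i, (f i).PosSemidef) (a : A) : (pushforward G f a).PosSemidef := by
  refine posSemidef_tsum fun i => ?_
  split_ifs
  exacts [hf i, .zero]

/-- Expectations commute with the relocation of mass; finiteness of the trace makes every fibre
summable. -/
theorem expectation_pushforward {G : ι → A} {f : ι → Matrix n n ℂ} (hf : ∀ i, (f i).PosSemidef)
    (ht : ∑' i, ENNReal.ofReal (f i).trace.re ≠ ⊤) (φ : A → InfPred n) :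
    expectation (pushforward G f) φ = ∑' i, (φ (G i)).expect (f i) := by
  classical
  have key : ∀ a, (φ a).expect (pushforward G f a)
      = ∑' i, if a = G i then (φ (G i)).expect (f i) else 0 := fun a => by
    have hp : ∀ i, (if G i = a then f i else 0).PosSemidef := fun i => by
      split_ifs
      exacts [hf i, .zero]
    simp only [pushforward]
    rw [InfPred.expect_tsum _ (by convert hp)]
    · refine tsum_congr fun i => ?_
      by_cases h : G i = a
      · simp [h]
      · simp [h, Ne.symm h, InfPred.expect_zero]
    · refine summable_of_trace (by convert hp) (ne_top_of_le_ne_top ht ?_)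
      refine ENNReal.tsum_le_tsum fun i => ?_
      split_ifs <;> simp
  simp only [expectation, key]
  rw [ENNReal.tsum_comm]
  exact tsum_congr fun i => tsum_ite_eq _ _

theorem posSemidef_marg₂ {Δ : CQFun (A₁ × A₂) (n₁ × n₂)} (h : ∀ a, (Δ a).PosSemidef) (a : A₁) :
    (marg₂ Δ a).PosSemidef :=
  posSemidef_tsum fun _ => posSemidef_ptr₂ (h _)

theorem posSemidef_marg₁ {Δ : CQFun (A₁ × A₂) (n₁ × n₂)} (h : ∀ a, (Δ a).PosSemidef) (a : A₂) :
    (marg₁ Δ a).PosSemidef :=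
  posSemidef_tsum fun _ => posSemidef_ptr₁ (h _)

theorem expectation_marg₂ {Δ : CQFun (A₁ × A₂) (n₁ × n₂)} (h : ∀ a, (Δ a).PosSemidef)
    (ht : totalTrace Δ ≠ ⊤) (φ : A₁ → InfPred n₁) :
    expectation (marg₂ Δ) φ = expectation Δ fun a => (φ a.1).tensorId := by
  rw [totalTrace, ENNReal.tsum_prod'] at ht
  simp only [expectation, marg₂]
  rw [ENNReal.tsum_prod']
  refine tsum_congr fun a₁ => ?_
  rw [InfPred.expect_tsum _ fun _ => posSemidef_ptr₂ (h _)]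
  · exact tsum_congr fun a₂ => (InfPred.expect_tensorId _ (h _)).symm
  · refine summable_of_trace (fun _ => posSemidef_ptr₂ (h _)) (ne_top_of_le_ne_top ht ?_)
    simp only [trace_ptr₂]
    exact ENNReal.le_tsum (f := fun a₁ => ∑' a₂, ENNReal.ofReal (Δ (a₁, a₂)).trace.re) a₁

theorem expectation_marg₁ {Δ : CQFun (A₁ × A₂) (n₁ × n₂)} (h : ∀ a, (Δ a).PosSemidef)
    (ht : totalTrace Δ ≠ ⊤) (φ : A₂ → InfPred n₂) :
    expectation (marg₁ Δ) φ = expectation Δ fun a => (φ a.2).idTensor := by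
  rw [totalTrace, ENNReal.tsum_prod', ENNReal.tsum_comm] at ht
  simp only [expectation, marg₁]
  rw [ENNReal.tsum_prod', ENNReal.tsum_comm]
  refine tsum_congr fun a₂ => ?_
  rw [InfPred.expect_tsum _ fun _ => posSemidef_ptr₁ (h _)]
  · exact tsum_congr fun a₁ => (InfPred.expect_idTensor _ (h _)).symm
  · refine summable_of_trace (fun _ => posSemidef_ptr₁ (h _)) (ne_top_of_le_ne_top ht ?_)
    simp only [trace_ptr₁]
    exact ENNReal.le_tsum (f := fun a₂ => ∑' a₁, ENNReal.ofReal (Δ (a₁, a₂)).trace.re) a₂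

theorem expect_tensorId_one {ρ : Matrix (n₁ × n₂) (n₁ × n₂) ℂ} (h : ρ.PosSemidef) :
    ((1 : InfPred n₁).tensorId (n := n₂)).expect ρ = ENNReal.ofReal ρ.trace.re := by
  rw [InfPred.expect_tensorId _ h, InfPred.expect_one (posSemidef_ptr₂ h), trace_ptr₂]

theorem expect_idTensor_one {ρ : Matrix (n₁ × n₂) (n₁ × n₂) ℂ} (h : ρ.PosSemidef) :
    ((1 : InfPred n₂).idTensor (m := n₁)).expect ρ = ENNReal.ofReal ρ.trace.re := by
  rw [InfPred.expect_idTensor _ h, InfPred.expect_one (posSemidef_ptr₁ h), trace_ptr₁]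

theorem totalTrace_marg₂ {Δ : CQFun (A₁ × A₂) (n₁ × n₂)} (h : ∀ a, (Δ a).PosSemidef)
    (ht : totalTrace Δ ≠ ⊤) : totalTrace (marg₂ Δ) = totalTrace Δ := by
  rw [totalTrace_eq_expectation (posSemidef_marg₂ h), expectation_marg₂ h ht]
  exact tsum_congr fun a => expect_tensorId_one (h a)

theorem totalTrace_marg₁ {Δ : CQFun (A₁ × A₂) (n₁ × n₂)} (h : ∀ a, (Δ a).PosSemidef)
    (ht : totalTrace Δ ≠ ⊤) : totalTrace (marg₁ Δ) = totalTrace Δ := by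
  rw [totalTrace_eq_expectation (posSemidef_marg₁ h), expectation_marg₁ h ht]
  exact tsum_congr fun a => expect_idTensor_one (h a)

theorem expectation_tsum {Δ : ι → CQFun A n} (h : ∀ i a, (Δ i a).PosSemidef)
    (ht : ∑' i, totalTrace (Δ i) ≠ ⊤) (φ : A → InfPred n) :
    (expectation (fun a => ∑' i, Δ i a) φ) = ∑' i, expectation (Δ i) φ := by
  simp only [expectation]
  rw [ENNReal.tsum_comm]
  refine tsum_congr fun a => ?_
  refine InfPred.expect_tsum _ (fun i => h i a) (summable_of_trace (fun i => h i a) ?_)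
  exact ne_top_of_le_ne_top ht (ENNReal.tsum_le_tsum fun i =>
    ENNReal.le_tsum (f := fun a => ENNReal.ofReal (Δ i a).trace.re) a)

theorem expectation_add_left {Δ Δ' : CQFun A n} (h : ∀ a, (Δ a).PosSemidef)
    (h' : ∀ a, (Δ' a).PosSemidef) (φ : A → InfPred n) :
    expectation (Δ + Δ') φ = expectation Δ φ + expectation Δ' φ := by
  simp only [expectation, Pi.add_apply, fun a => InfPred.expect_add_right (φ a) (h a) (h' a)]
  exact ENNReal.tsum_add

/-- The assertion that is `φ` where `b` holds and the zero predicate elsewhere. -/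
def select (b : A → Bool) (φ : A → InfPred n) : A → InfPred n :=
  fun a => if b a then φ a else (0 : ℝ≥0∞) • 1

theorem posSemidef_restrict {n : Type*} [Fintype n] (b : A → Bool) {Δ : CQFun A n}
    (h : ∀ a, (Δ a).PosSemidef) (a : A) : (restrict b Δ a).PosSemidef := by
  unfold restrict
  split_ifs
  exacts [h a, .zero]

theorem expectation_restrict (b : A → Bool) {Δ : CQFun A n} (h : ∀ a, (Δ a).PosSemidef)
    (φ : A → InfPred n) : expectation (restrict b Δ) φ = expectation Δ (select b φ) := by
  refine tsum_congr fun a => ?_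
  unfold restrict select
  split_ifs
  · rfl
  · rw [InfPred.expect_zero, InfPred.expect_smul _ _ (h a), zero_mul]

theorem totalTrace_restrict_add {n : Type*} [Fintype n] (b : A → Bool) (Δ : CQFun A n) :
    totalTrace (restrict b Δ) + totalTrace (restrict (fun a => !b a) Δ) = totalTrace Δ := by
  simp only [totalTrace, ← ENNReal.tsum_add]
  refine tsum_congr fun a => ?_
  cases h : b a <;> simp [restrict, h]

end Functions

/-! ### Operators on registers and Kraus families -/

section Kraus

open scoped Kronecker

variable {m n ι : Type*} [Fintype m] [DecidableEq m] [Fintype n] [DecidableEq n]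

theorem sum_enorm_mulVec {K : ι → Matrix n n ℂ} (hK : HasSum (fun i => (K i)ᴴ * K i) 1)
    (x : n → ℂ) : ∑' i, ∑ j, ‖(K i *ᵥ x) j‖ₑ ^ 2 = ∑ j, ‖x j‖ₑ ^ 2 := by
  have e : ∀ y : n → ℂ, (star y ⬝ᵥ y).re = ∑ j, ‖y j‖ ^ 2 := fun y => by
    rw [dotProduct, Complex.re_sum]
    refine Finset.sum_congr rfl fun j _ => ?_
    rw [Pi.star_apply, Complex.star_def, Complex.conj_mul', ← Complex.ofReal_pow,
      Complex.ofReal_re]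
  have e' : ∀ y : n → ℂ, ∑ j, ‖y j‖ₑ ^ 2 = ENNReal.ofReal (star y ⬝ᵥ y).re := fun y => by
    rw [e, ENNReal.ofReal_sum_of_nonneg fun _ _ => by positivity]
    exact Finset.sum_congr rfl fun j _ => by rw [ENNReal.ofReal_pow (norm_nonneg _), ofReal_norm]
  let L : Matrix n n ℂ →+ ℝ := AddMonoidHom.mk' (fun M => (star x ⬝ᵥ (M *ᵥ x)).re)
    fun M N => by rw [Matrix.add_mulVec, dotProduct_add, Complex.add_re]
  have hc : Continuous L :=
    Complex.continuous_re.comp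
      (show Continuous fun M : Matrix n n ℂ => star x ⬝ᵥ (M *ᵥ x) by fun_prop)
  have h := hK.map L hc
  have h1 : L 1 = (star x ⬝ᵥ x).re := by
    change (star x ⬝ᵥ ((1 : Matrix n n ℂ) *ᵥ x)).re = _
    rw [Matrix.one_mulVec]
  have h2 : ∀ i, L ((K i)ᴴ * K i) = (star (K i *ᵥ x) ⬝ᵥ (K i *ᵥ x)).re := fun i => by
    change (star x ⬝ᵥ (((K i)ᴴ * K i) *ᵥ x)).re = _
    rw [Matrix.star_mulVec, ← Matrix.dotProduct_mulVec, Matrix.mulVec_mulVec]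
  simp only [e']
  rw [← h1, ← h.tsum_eq, ENNReal.ofReal_tsum_of_nonneg _ h.summable]
  · exact tsum_congr fun i => by rw [Function.comp_apply, h2]
  · intro i
    rw [Function.comp_apply, h2, e]
    positivity

theorem sum_conj_one {K : ι → Matrix n n ℂ} (hK : HasSum (fun i => (K i)ᴴ * K i) 1) :
    (InfPred.sum fun i => (1 : InfPred n).conj (K i)) = 1 :=
  InfPred.ext (funext fun x => sum_enorm_mulVec hK x)

/-- A Kraus family on one factor does not change a predicate on the other factor. -/
theorem sum_form_kronecker_one {K : ι → Matrix m m ℂ} (hK : HasSum (fun i => (K i)ᴴ * K i) 1)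
    (A : InfPred n) (w : m × n → ℂ) :
    ∑' i, (A.idTensor (m := m)).form ((K i ⊗ₖ (1 : Matrix n n ℂ)) *ᵥ w)
      = (A.idTensor (m := m)).form w := by
  obtain ⟨U, lam, h⟩ := A.spectral
  -- in the eigenbasis of `A`, every component of `w` is a vector of the other factor
  have key : ∀ z : m × n → ℂ, (A.idTensor (m := m)).form z
      = ∑ l, lam l * ∑ j, ‖((U : Matrix n n ℂ)ᴴ *ᵥ fun k => z (j, k)) l‖ₑ ^ 2 := fun z => by
    change ∑ j, A.form _ = _
    simp only [h, Finset.mul_sum]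
    exact Finset.sum_comm
  have comm : ∀ i j l, ((U : Matrix n n ℂ)ᴴ *ᵥ fun k => ((K i ⊗ₖ (1 : Matrix n n ℂ)) *ᵥ w) (j, k)) l
      = (K i *ᵥ fun j => ((U : Matrix n n ℂ)ᴴ *ᵥ fun k => w (j, k)) l) j := fun i j l => by
    simp only [Matrix.mulVec, dotProduct, Fintype.sum_prod_type, Matrix.kroneckerMap_apply,
      Matrix.one_apply, mul_ite, mul_one, mul_zero, ite_mul, zero_mul, Finset.sum_ite_eq,
      Finset.mem_univ, if_true, Finset.mul_sum]
    rw [Finset.sum_comm]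
    exact Finset.sum_congr rfl fun _ _ => Finset.sum_congr rfl fun _ _ => by ring
  simp only [key, comm]
  rw [Summable.tsum_finsetSum fun _ _ => ENNReal.summable]
  refine Finset.sum_congr rfl fun l _ => ?_
  rw [ENNReal.tsum_mul_left, sum_enorm_mulVec hK]

/-- The mirror image of `sum_form_kronecker_one`. -/
theorem sum_form_one_kronecker {K : ι → Matrix n n ℂ} (hK : HasSum (fun i => (K i)ᴴ * K i) 1)
    (A : InfPred m) (w : m × n → ℂ) :
    ∑' i, (A.tensorId (n := n)).form (((1 : Matrix m m ℂ) ⊗ₖ K i) *ᵥ w)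
      = (A.tensorId (n := n)).form w := by
  obtain ⟨U, lam, h⟩ := A.spectral
  have key : ∀ z : m × n → ℂ, (A.tensorId (n := n)).form z
      = ∑ l, lam l * ∑ k, ‖((U : Matrix m m ℂ)ᴴ *ᵥ fun j => z (j, k)) l‖ₑ ^ 2 := fun z => by
    change ∑ k, A.form _ = _
    simp only [h, Finset.mul_sum]
    exact Finset.sum_comm
  have comm : ∀ i k l, ((U : Matrix m m ℂ)ᴴ *ᵥ fun j => (((1 : Matrix m m ℂ) ⊗ₖ K i) *ᵥ w) (j, k)) l
      = (K i *ᵥ fun k => ((U : Matrix m m ℂ)ᴴ *ᵥ fun j => w (j, k)) l) k := fun i k l => by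
    simp only [Matrix.mulVec, dotProduct, Fintype.sum_prod_type_right, Matrix.kroneckerMap_apply,
      Matrix.one_apply, one_mul, ite_mul, zero_mul, Finset.sum_ite_eq,
      Finset.mem_univ, if_true, Finset.mul_sum]
    rw [Finset.sum_comm]
    exact Finset.sum_congr rfl fun _ _ => Finset.sum_congr rfl fun _ _ => by ring
  simp only [key, comm]
  rw [Summable.tsum_finsetSum fun _ _ => ENNReal.summable]
  refine Finset.sum_congr rfl fun l _ => ?_
  rw [ENNReal.tsum_mul_left, sum_enorm_mulVec hK]

variable {V Q : Type*} {D : Q → Type*} [Fintype Q] [DecidableEq Q] [∀ q, Fintype (D q)]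
  [∀ q, DecidableEq (D q)]

theorem embed_eq_kronecker {D : Q → Type*} [∀ q, DecidableEq (D q)] (S : Finset Q)
    (A : Matrix (RIdx D S) (RIdx D S) ℂ) :
    embed S A = (A ⊗ₖ (1 : Matrix (∀ q : {q // q ∉ S}, D q) (∀ q : {q // q ∉ S}, D q) ℂ)).submatrix
      (Equiv.piEquivPiSubtypeProd (· ∈ S) D) (Equiv.piEquivPiSubtypeProd (· ∈ S) D) := by
  ext s t
  simp only [embed, Matrix.of_apply, Matrix.submatrix_apply, Matrix.kroneckerMap_apply,
    Matrix.one_apply, Equiv.piEquivPiSubtypeProd_apply, mul_ite, mul_one, mul_zero, funext_iff,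
    Subtype.forall]

theorem embed_conjTranspose_mul (S : Finset Q) (A B : Matrix (RIdx D S) (RIdx D S) ℂ) :
    (embed S A)ᴴ * embed S B = embed S (Aᴴ * B) := by
  simp only [embed_eq_kronecker, Matrix.conjTranspose_submatrix, Matrix.submatrix_mul_equiv,
    Matrix.conjTranspose_kronecker, Matrix.conjTranspose_one, ← Matrix.mul_kronecker_mul, mul_one]

theorem embed_one {D : Q → Type*} [∀ q, DecidableEq (D q)] (S : Finset Q) :
    embed S (1 : Matrix (RIdx D S) (RIdx D S) ℂ) = 1 := by
  rw [embed_eq_kronecker, Matrix.one_kronecker_one, Matrix.submatrix_one_equiv]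

theorem hasSum_embed {S : Finset Q} {K : ι → Matrix (RIdx D S) (RIdx D S) ℂ}
    (hK : HasSum (fun i => (K i)ᴴ * K i) 1) :
    HasSum (fun i => (embed S (K i))ᴴ * embed S (K i)) 1 := by
  simp only [embed_conjTranspose_mul]
  let L : Matrix (RIdx D S) (RIdx D S) ℂ →+ Matrix (QIdx D) (QIdx D) ℂ :=
    AddMonoidHom.mk' (embed S) fun M N => by
      ext s t
      simp only [embed, Matrix.of_apply, Matrix.add_apply]
      split_ifs <;> simp
  have hc : Continuous L := by
    refine continuous_matrix fun s t => ?_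
    change Continuous fun M : Matrix (RIdx D S) (RIdx D S) ℂ =>
      if ∀ q ∉ S, s q = t q then M (fun q => s q) (fun q => t q) else 0
    split_ifs
    · exact continuous_id.matrix_elem _ _
    · exact continuous_const
  have := hK.map L hc
  rwa [show L 1 = 1 from embed_one S] at this

theorem hasSum_initOp (S : Finset Q) (v : {w : RIdx D S → ℂ // star w ⬝ᵥ w = 1}) :
    HasSum (fun i => (initOp S v.1 i)ᴴ * initOp S v.1 i) 1 := by
  refine hasSum_embed ?_
  have h : ∑ i, (Matrix.vecMulVec v.1 (Pi.single i 1))ᴴ * Matrix.vecMulVec v.1 (Pi.single i 1)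
      = (1 : Matrix (RIdx D S) (RIdx D S) ℂ) := by
    ext s t
    simp only [Matrix.conjTranspose_vecMulVec, Matrix.vecMulVec_mul_vecMulVec, v.2, one_smul,
      Matrix.sum_apply, Matrix.vecMulVec_apply, Pi.star_apply, Pi.single_apply, Matrix.one_apply]
    simp
  rw [← h]
  exact hasSum_fintype _

theorem hasSum_unitary (S : Finset Q) (U : Matrix.unitaryGroup (RIdx D S) ℂ) :
    HasSum (fun _ : Unit => (embed S (U : Matrix (RIdx D S) (RIdx D S) ℂ))ᴴ *
      embed S (U : Matrix (RIdx D S) (RIdx D S) ℂ)) 1 := by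
  refine hasSum_embed ?_
  rw [← Matrix.star_eq_conjTranspose, Matrix.mem_unitaryGroup_iff'.1 U.2]
  exact hasSum_unique _

end Kraus

/-! ### Weakest preconditions -/

section Wp

variable {C V Q : Type*} {D : Q → Type*} [Fintype Q] [DecidableEq Q] [∀ q, Fintype (D q)]
  [∀ q, DecidableEq (D q)] [DecidableEq C]

/-- The weakest precondition: the assertion whose expectation in `Δ` is the expectation of `φ` in
`sem c Δ`. A loop contributes the sum over the number of iterations after which it exits. -/
def wp : Cmd C V D → Assn C V D → Assn C V D
  | .skip, φ => φ
  | .abort, _ => fun _ => (0 : ℝ≥0∞) • 1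
  | .assign x e, φ => fun σ => φ (Function.update σ x (e σ))
  | .sample x μ, φ => fun σ => .sum fun v => μ v • φ (Function.update σ x v)
  | .init S v, φ => fun σ => .sum fun i => (φ σ).conj (initOp S (v σ).1 i)
  | .apply S U, φ => fun σ => (φ σ).conj (embed S (U : Matrix (RIdx D S) (RIdx D S) ℂ))
  | .meas x S M, φ => fun σ => .sum fun v => (φ (Function.update σ x v)).conj (embed S (M.op v))
  | .seq c c', φ => wp c (wp c' φ)
  | .ite b c c', φ => fun σ => if b σ then wp c φ σ else wp c' φ σ
  | .loop b c, φ => fun σ =>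
      .sum fun k : ℕ => (fun χ => select b (wp c χ))^[k] (select (fun σ => !b σ) φ) σ

section Sum

variable {ι A n : Type*} [Fintype n] [DecidableEq n]

theorem select_sum (b : A → Bool) (φ : ι → A → InfPred n) :
    select b (fun a => .sum fun i => φ i a) = fun a => .sum fun i => select b (φ i) a := by
  funext a
  unfold select
  split_ifs
  · rfl
  · refine InfPred.ext (funext fun u => ?_)
    change 0 * _ = ∑' _, 0 * _
    simp

end Sum

/-- Weakest preconditions are countably additive. -/
theorem wp_sum {ι : Type*} (c : Cmd C V D) (φ : ι → Assn C V D) :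
    wp c (fun σ => .sum fun i => φ i σ) = fun σ => .sum fun i => wp c (φ i) σ := by
  induction c generalizing ι φ with
  | skip => rfl
  | abort =>
    refine funext fun σ => InfPred.ext (funext fun u => ?_)
    change 0 * _ = ∑' _, 0 * _
    simp
  | assign x e => rfl
  | sample x μ =>
    refine funext fun σ => InfPred.ext (funext fun u => ?_)
    change ∑' v, μ v * ∑' i, _ = ∑' i, ∑' v, μ v * _
    simp only [← ENNReal.tsum_mul_left]
    exact ENNReal.tsum_comm
  | init S v =>
    refine funext fun σ => InfPred.ext (funext fun u => ?_)
    exact ENNReal.tsum_comm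
  | apply S U => rfl
  | meas x S M =>
    refine funext fun σ => InfPred.ext (funext fun u => ?_)
    exact ENNReal.tsum_comm
  | seq c c' ih ih' => simp only [wp, ih', ih]
  | ite b c c' ih ih' =>
    funext σ
    simp only [wp, ih, ih']
    split_ifs <;> rfl
  | loop b c ih =>
    have iter : ∀ (k : ℕ) (χ : ι → Assn C V D),
        (fun χ => select b (wp c χ))^[k] (fun σ => .sum fun i => χ i σ)
          = fun σ => .sum fun i => (fun χ => select b (wp c χ))^[k] (χ i) σ := by
      intro k
      induction k with
      | zero => exact fun χ => rfl
      | succ k ihk =>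
        intro χ
        simp only [Function.iterate_succ_apply, ih, select_sum, ihk]
    refine funext fun σ => InfPred.ext (funext fun u => ?_)
    simp only [wp, select_sum, iter]
    exact ENNReal.tsum_comm

/-- The fixed-point equation of the weakest precondition of a loop, where the guard holds: the term
for zero iterations vanishes, and the other terms are `wp c` of the terms of the series. -/
theorem wp_loop_of_true {b : CState C V → Bool} {c : Cmd C V D} (φ : Assn C V D) {σ : CState C V}
    (h : b σ = true) : wp (.loop b c) φ σ = wp c (wp (.loop b c) φ) σ := by
  have e : wp c (wp (.loop b c) φ) = fun σ => .sum fun k : ℕ =>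
      wp c ((fun χ => select b (wp c χ))^[k] (select (fun σ => !b σ) φ)) σ := wp_sum c _
  rw [e]
  refine InfPred.ext (funext fun u => ?_)
  change ∑' k : ℕ, _ = ∑' k : ℕ, _
  rw [tsum_eq_zero_add' ENNReal.summable]
  simp [Function.iterate_succ_apply', select, h, InfPred.form_zero_smul]

theorem wp_loop_of_false {b : CState C V → Bool} {c : Cmd C V D} (φ : Assn C V D) {σ : CState C V}
    (h : b σ = false) : wp (.loop b c) φ σ = φ σ := by
  refine InfPred.ext (funext fun u => ?_)
  change ∑' k : ℕ, _ = _
  rw [tsum_eq_zero_add' ENNReal.summable]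
  simp only [Function.iterate_zero, id_eq, Function.iterate_succ_apply', select, h]
  simp [InfPred.form_zero_smul]

end Wp

/-! ### Adequacy of weakest preconditions -/

section Adequacy

variable {C V Q : Type*} {D : Q → Type*} [Fintype Q] [DecidableEq Q] [∀ q, Fintype (D q)]
  [∀ q, DecidableEq (D q)] [DecidableEq C]

/-- What the semantics `F` of a command and its weakest precondition `W` have in common: for
positive `Δ` of finite trace, `F Δ` is positive, of no larger trace, and `W` gives expectations
in it. -/
def Adequate {A n : Type*} [Fintype n] [DecidableEq n] (F : CQFun A n → CQFun A n)
    (W : (A → InfPred n) → A → InfPred n) : Prop :=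
  ∀ Δ : CQFun A n, (∀ a, (Δ a).PosSemidef) → totalTrace Δ ≠ ⊤ →
    (∀ a, (F Δ a).PosSemidef) ∧ totalTrace (F Δ) ≤ totalTrace Δ ∧
      ∀ φ, expectation (F Δ) φ = expectation Δ (W φ)

/-- The trace bound follows from the formula for expectations if `W` maps `1` to `1`. -/
theorem adequate_of_one {A n : Type*} [Fintype n] [DecidableEq n] {F : CQFun A n → CQFun A n}
    {W : (A → InfPred n) → A → InfPred n} (h1 : (W fun _ => 1) = fun _ => 1)
    (h : ∀ Δ : CQFun A n, (∀ a, (Δ a).PosSemidef) → totalTrace Δ ≠ ⊤ →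
      (∀ a, (F Δ a).PosSemidef) ∧ ∀ φ, expectation (F Δ) φ = expectation Δ (W φ)) :
    Adequate F W := fun Δ hΔ ht => by
  obtain ⟨hp, he⟩ := h Δ hΔ ht
  refine ⟨hp, ?_, he⟩
  rw [totalTrace_eq_expectation hp, totalTrace_eq_expectation hΔ, he, h1]

/-- Adequacy of a random choice `E` with an outcome in `V` that is stored in `x`; `W` is the dual of
`E` on families of predicates. -/
theorem adequate_outcome {n : Type*} [Fintype n] [DecidableEq n] (x : C)
    (E : Matrix n n ℂ → CQFun V n) (W : (V → InfPred n) → InfPred n) (hW : W (fun _ => 1) = 1)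
    (hE : ∀ ρ v, ρ.PosSemidef → (E ρ v).PosSemidef)
    (hEW : ∀ ρ A, ρ.PosSemidef → ∑' v, (A v).expect (E ρ v) = (W A).expect ρ) :
    Adequate (A := CState C V) (outcome x E)
      (fun φ σ => W fun v => φ (Function.update σ x v)) := by
  refine adequate_of_one (by simp only [hW]) fun Δ hΔ ht => ?_
  have e : outcome x E Δ = pushforward (fun p : CState C V × V => Function.update p.1 x p.2)
      (fun p => E (Δ p.1) p.2) := rfl
  have hp : ∀ p : CState C V × V, (E (Δ p.1) p.2).PosSemidef := fun p => hE _ _ (hΔ _)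
  rw [e]
  refine ⟨posSemidef_pushforward hp, fun φ => ?_⟩
  rw [expectation_pushforward hp]
  · refine (ENNReal.tsum_prod' (f := fun p : CState C V × V =>
      (φ (Function.update p.1 x p.2)).expect (E (Δ p.1) p.2))).trans ?_
    exact tsum_congr fun σ => hEW (Δ σ) (fun v => φ (Function.update σ x v)) (hΔ σ)
  · convert ht using 1
    refine (ENNReal.tsum_prod' (f := fun p : CState C V × V =>
      ENNReal.ofReal (E (Δ p.1) p.2).trace.re)).trans (tsum_congr fun σ => ?_)
    simp only [fun v => (InfPred.expect_one (hp (σ, v))).symm]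
    rw [hEW (Δ σ) (fun _ => 1) (hΔ σ), hW, InfPred.expect_one (hΔ σ)]

theorem sum_pmf_smul {n : Type*} [Fintype n] [DecidableEq n] (μ : PMF V) (A : InfPred n) :
    (InfPred.sum fun v => μ v • A) = A := by
  refine InfPred.ext (funext fun u => ?_)
  change ∑' v, μ v * A.form u = _
  rw [ENNReal.tsum_mul_right, μ.tsum_coe, one_mul]

/-- Adequacy passes to loops. Since the body does not increase the trace, the total mass that leaves
the loop is bounded by the initial mass, so the series that defines the loop converges. -/
theorem adequate_loop {A n : Type*} [Fintype n] [DecidableEq n] {F : CQFun A n → CQFun A n}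
    {W : (A → InfPred n) → A → InfPred n} (h : Adequate F W) (b : A → Bool) :
    Adequate
      (fun Δ τ => ∑' k : ℕ, restrict (fun a => !b a) ((fun Γ => F (restrict b Γ))^[k] Δ) τ)
      (fun φ a => .sum fun k : ℕ =>
        (fun χ => select b (W χ))^[k] (select (fun a => !b a) φ) a) := by
  intro Δ hΔ ht
  set Γ : ℕ → CQFun A n := fun k => (fun Γ => F (restrict b Γ))^[k] Δ
  have Γs : ∀ k, Γ (k + 1) = F (restrict b (Γ k)) := fun k => Function.iterate_succ_apply' _ _ _
  have step : ∀ {Θ : CQFun A n}, totalTrace Θ ≠ ⊤ → totalTrace (restrict b Θ) ≠ ⊤ :=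
    fun {Θ} hΘ => ne_top_of_le_ne_top hΘ (le_self_add.trans_eq (totalTrace_restrict_add b Θ))
  have inv : ∀ k, (∀ a, (Γ k a).PosSemidef) ∧ totalTrace (Γ k) ≠ ⊤ := by
    intro k
    induction k with
    | zero => exact ⟨hΔ, ht⟩
    | succ k ih =>
      obtain ⟨h1, h2, -⟩ := h _ (posSemidef_restrict b ih.1) (step ih.2)
      rw [Γs]
      exact ⟨h1, ne_top_of_le_ne_top (step ih.2) h2⟩
  have psd : ∀ k a, (restrict (fun a => !b a) (Γ k) a).PosSemidef := fun k =>
    posSemidef_restrict _ (inv k).1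
  -- the mass that has left the loop and the mass that is still inside
  have mass : ∀ N, ∑ k ∈ Finset.range N, totalTrace (restrict (fun a => !b a) (Γ k))
      + totalTrace (Γ N) ≤ totalTrace Δ := by
    intro N
    induction N with
    | zero => simp [Γ]
    | succ N ih =>
      refine le_trans ?_ ih
      rw [Finset.sum_range_succ, add_assoc, ← totalTrace_restrict_add b (Γ N), Γs,
        add_comm (totalTrace (restrict b _))]
      gcongr
      exact (h _ (posSemidef_restrict b (inv N).1) (step (inv N).2)).2.1
  have total : ∑' k, totalTrace (restrict (fun a => !b a) (Γ k)) ≤ totalTrace Δ :=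
    ENNReal.tsum_le_of_sum_range_le fun N => le_self_add.trans (mass N)
  have hex := expectation_tsum psd (ne_top_of_le_ne_top ht total)
  have iter : ∀ k χ, expectation (Γ k) χ = expectation Δ ((fun χ => select b (W χ))^[k] χ) := by
    intro k
    induction k with
    | zero => exact fun χ => rfl
    | succ k ih =>
      intro χ
      rw [Γs, (h _ (posSemidef_restrict b (inv k).1) (step (inv k).2)).2.2,
        expectation_restrict b (inv k).1, ih, Function.iterate_succ_apply]
  have psd' : ∀ a, (∑' k, restrict (fun a => !b a) (Γ k) a).PosSemidef := fun a =>
    posSemidef_tsum fun k => psd k a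
  refine ⟨psd', ?_, fun φ => ?_⟩
  · rw [totalTrace_eq_expectation psd', hex]
    simp only [← totalTrace_eq_expectation (psd _)]
    exact total
  · rw [hex, expectation_sum hΔ]
    exact tsum_congr fun k => by rw [expectation_restrict _ (inv k).1, iter]

theorem adequate_wp (c : Cmd C V D) : Adequate (sem c) (wp c) := by
  induction c with
  | skip => exact fun Δ hΔ _ => ⟨hΔ, le_rfl, fun φ => rfl⟩
  | abort =>
    intro Δ hΔ _
    refine ⟨fun _ => .zero, by simp [sem, totalTrace], fun φ => ?_⟩
    simp only [expectation, wp, sem, Pi.zero_apply, InfPred.expect_zero,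
      fun a => InfPred.expect_smul 0 1 (hΔ a), zero_mul]
  | assign x e =>
    refine adequate_of_one rfl fun Δ hΔ ht => ?_
    have e : sem (.assign x e : Cmd C V D) Δ = pushforward (fun σ => Function.update σ x (e σ)) Δ :=
      rfl
    rw [e]
    exact ⟨posSemidef_pushforward hΔ, expectation_pushforward hΔ ht⟩
  | sample x μ =>
    refine adequate_outcome x (evalDist μ) (fun A => .sum fun v => μ v • A v) (sum_pmf_smul μ 1)
      (fun ρ v h => h.smul (by simp)) fun ρ A h => ?_
    rw [InfPred.expect_sum _ h]
    refine tsum_congr fun v => ?_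
    rw [InfPred.expect_smul _ _ h, evalDist, InfPred.expect_smul_right _ ENNReal.toReal_nonneg,
      ENNReal.ofReal_toReal (μ.apply_ne_top v)]
  | init S v =>
    have key : ∀ σ, HasSum (fun i => (initOp S (v σ).1 i)ᴴ * initOp S (v σ).1 i) 1 := fun σ =>
      hasSum_initOp S (v σ)
    refine adequate_of_one (funext fun σ => sum_conj_one (key σ)) fun Δ hΔ ht =>
      ⟨fun σ => Matrix.posSemidef_sum _ fun i _ => (hΔ σ).mul_mul_conjTranspose_same _,
        fun φ => tsum_congr fun σ => ?_⟩
    simp only [wp, InfPred.expect_sum _ (hΔ σ)]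
    simp only [sem, ← tsum_fintype (L := .unconditional _)]
    rw [InfPred.expect_tsum _ (fun i => (hΔ σ).mul_mul_conjTranspose_same _)
      (hasSum_fintype _).summable]
    exact tsum_congr fun i => (InfPred.expect_conj _ _ (hΔ σ)).symm
  | apply S U =>
    refine adequate_of_one (funext fun σ => ?_) fun Δ hΔ ht => ⟨fun σ => ?_, fun φ => ?_⟩
    · refine InfPred.ext (funext fun u => ?_)
      have := sum_enorm_mulVec (hasSum_unitary S U) u
      rwa [tsum_fintype, Fintype.sum_unique] at this
    · exact (hΔ σ).mul_mul_conjTranspose_same _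
    · exact tsum_congr fun σ => (InfPred.expect_conj _ _ (hΔ σ)).symm
  | meas x S M =>
    refine adequate_outcome x (evalMeas S M) (fun A => .sum fun v => (A v).conj (embed S (M.op v)))
      (sum_conj_one (hasSum_embed M.complete)) (fun ρ v h => h.mul_mul_conjTranspose_same _)
      fun ρ A h => ?_
    rw [InfPred.expect_sum _ h]
    exact tsum_congr fun v => (InfPred.expect_conj _ _ h).symm
  | seq c c' ih ih' =>
    intro Δ hΔ ht
    obtain ⟨h1, h2, h3⟩ := ih Δ hΔ ht
    obtain ⟨h1', h2', h3'⟩ := ih' _ h1 (ne_top_of_le_ne_top ht h2)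
    exact ⟨h1', h2'.trans h2, fun φ => (h3' φ).trans (h3 _)⟩
  | ite b c c' ih ih' =>
    intro Δ hΔ ht
    have hb := totalTrace_restrict_add b Δ
    obtain ⟨h1, h2, h3⟩ := ih (restrict b Δ) (posSemidef_restrict b hΔ)
      (ne_top_of_le_ne_top ht (hb ▸ le_self_add))
    obtain ⟨h1', h2', h3'⟩ := ih' (restrict (fun σ => !b σ) Δ) (posSemidef_restrict _ hΔ)
      (ne_top_of_le_ne_top ht (hb ▸ le_add_self))
    have psd : ∀ σ, (sem (.ite b c c') Δ σ).PosSemidef := fun σ => (h1 σ).add (h1' σ)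
    refine ⟨psd, ?_, fun φ => ?_⟩
    · rw [← hb, totalTrace_eq_expectation psd]
      simp only [sem]
      rw [expectation_add_left h1 h1', ← totalTrace_eq_expectation h1,
        ← totalTrace_eq_expectation h1']
      exact add_le_add h2 h2'
    · simp only [sem]
      rw [expectation_add_left h1 h1', h3, h3', expectation_restrict b hΔ,
        expectation_restrict _ hΔ, ← expectation_add hΔ]
      congr 1
      funext σ
      refine InfPred.ext (funext fun u => ?_)
      cases h : b σ
      · simp only [select, wp, h]
        exact (congrArg (· + _) (zero_mul _)).trans (zero_add _)
      · simp only [select, wp, h]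
        exact (congrArg (_ + ·) (zero_mul _)).trans (add_zero _)
  | loop b c ih => exact adequate_loop ih b

end Adequacy

/-! ### Expectations in relational states -/

section RelationalStates

variable {C₁ C₂ V Q₁ Q₂ : Type*} {D₁ : Q₁ → Type*} {D₂ : Q₂ → Type*}
  [Fintype Q₁] [DecidableEq Q₁] [∀ q, Fintype (D₁ q)] [∀ q, DecidableEq (D₁ q)]
  [Fintype Q₂] [DecidableEq Q₂] [∀ q, Fintype (D₂ q)] [∀ q, DecidableEq (D₂ q)]

theorem CQState.totalTrace_ne_top {A n : Type*} [Fintype n] (Δ : CQState A n) :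
    totalTrace Δ.val ≠ ⊤ :=
  ne_top_of_le_ne_top ENNReal.one_ne_top Δ.trace_le

/-- The expectation of a split assertion depends only on the marginals. -/
theorem expectation_split (Δ : RState C₁ C₂ V D₁ D₂) (φ₁ : Assn C₁ V D₁) (φ₂ : Assn C₂ V D₂) :
    expectation Δ.val (split φ₁ φ₂)
      = expectation (marg₂ Δ.val) φ₁ + expectation (marg₁ Δ.val) φ₂ := by
  rw [expectation_marg₂ Δ.psd Δ.totalTrace_ne_top, expectation_marg₁ Δ.psd Δ.totalTrace_ne_top,
    ← expectation_add Δ.psd]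
  rfl

theorem expectation_addConst (Δ : RState C₁ C₂ V D₁ D₂) (ψ : RAssn C₁ C₂ V D₁ D₂) (k : ℕ) :
    expectation Δ.val (addConst ψ k) = expectation Δ.val ψ + k * totalTrace Δ.val := by
  rw [totalTrace_eq_expectation Δ.psd]
  refine (expectation_add Δ.psd ψ fun _ => (k : ℝ≥0∞) • 1).trans ?_
  congr 1
  simp only [expectation, fun a => InfPred.expect_smul (k : ℝ≥0∞) 1 (Δ.psd a)]
  exact ENNReal.tsum_mul_left

end RelationalStates

/-! ### Derivations for split postconditions -/

section Derivations

variable {C₁ C₂ V Q₁ Q₂ : Type*} {D₁ : Q₁ → Type*} {D₂ : Q₂ → Type*}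
  [DecidableEq C₁] [DecidableEq C₂]
  [Fintype Q₁] [DecidableEq Q₁] [∀ q, Fintype (D₁ q)] [∀ q, DecidableEq (D₁ q)]
  [Fintype Q₂] [DecidableEq Q₂] [∀ q, Fintype (D₂ q)] [∀ q, DecidableEq (D₂ q)]

theorem InfPred.le_guard {n : Type*} [Fintype n] [DecidableEq n] {b : Prop} {A B : InfPred n}
    (h : b → A ≤ B) : A ≤ B.guard b := by
  unfold InfPred.guard
  split_ifs with hb
  · exact h hb
  · intro u
    change _ ≤ ⊤ * ∑ i, ‖u i‖ₑ ^ 2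
    by_cases hu : u = 0
    · simp [hu, InfPred.form_zero]
    · rw [ENNReal.top_mul]
      · exact le_top
      · obtain ⟨i, hi⟩ := Function.ne_iff.1 hu
        intro h0
        exact hi (by simpa using (Finset.sum_eq_zero_iff.1 h0) i (Finset.mem_univ i))

theorem Derivable.of_expectation_le {ψ ψ' φ : RAssn C₁ C₂ V D₁ D₂} {c₁ : Cmd C₁ V D₁}
    {c₂ : Cmd C₂ V D₂} (h : Derivable ψ' c₁ c₂ φ)
    (hψ : ∀ Δ : RState C₁ C₂ V D₁ D₂, expectation Δ.val ψ' ≤ expectation Δ.val ψ) :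
    Derivable ψ c₁ c₂ φ :=
  .conseq _ _ _ _ _ _ h fun Δ _ _ hΔ => hΔ.trans (hψ Δ)

theorem Derivable.of_le {ψ ψ' φ φ' : RAssn C₁ C₂ V D₁ D₂} {c₁ : Cmd C₁ V D₁}
    {c₂ : Cmd C₂ V D₂} (h : Derivable ψ' c₁ c₂ φ') (hψ : ∀ σ, ψ' σ ≤ ψ σ)
    (hφ : ∀ σ, φ σ ≤ φ' σ) : Derivable ψ c₁ c₂ φ :=
  .conseq _ _ _ _ _ _ h fun Δ _ _ hΔ =>
    ((iInf₂_mono fun Δ' _ => expectation_mono Δ'.psd hφ).trans hΔ).trans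
      (expectation_mono Δ.psd hψ)

/-- On a nontrivial space there is a state of trace one, which `abort` does not preserve. -/
theorem not_ast_abort {C V Q : Type*} {D : Q → Type*} [Fintype Q] [DecidableEq Q]
    [∀ q, Fintype (D q)] [∀ q, DecidableEq (D q)] [DecidableEq C] [Nonempty V]
    [∀ q, Nonempty (D q)] : ¬ AST (.abort : Cmd C V D) := by
  classical
  intro h
  obtain ⟨σ₀⟩ : Nonempty (CState C V) := inferInstance
  obtain ⟨s₀⟩ : Nonempty (QIdx D) := inferInstance
  let P : Matrix (QIdx D) (QIdx D) ℂ := Matrix.diagonal (Pi.single s₀ 1)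
  have hP : P.PosSemidef := Matrix.PosSemidef.diagonal (Pi.single_nonneg.2 zero_le_one)
  have ht : totalTrace (Pi.single σ₀ P : CQFun (CState C V) (QIdx D)) = 1 := by
    rw [totalTrace, tsum_eq_single σ₀ fun σ hσ => by simp [Pi.single_eq_of_ne hσ]]
    simp [P]
  have he := h ⟨Pi.single σ₀ P, fun σ => by
    by_cases hσ : σ = σ₀
    · subst hσ; simpa using hP
    · rw [Pi.single_eq_of_ne hσ]; exact .zero, ht.le⟩
  have h0 := he.trans ht
  simp [sem, totalTrace] at h0

theorem HAST.ast {C V Q : Type*} {D : Q → Type*} [Fintype Q] [DecidableEq Q]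
    [∀ q, Fintype (D q)] [∀ q, DecidableEq (D q)] [DecidableEq C] {c : Cmd C V D}
    (h : HAST c) : AST c := by
  cases c <;> first | exact h | exact h.1

open scoped Kronecker

/-- The one-sided preconditions of a Kraus family act only on the left summand of a split
predicate. -/
theorem sum_conjL_split {ι : Type*} {K : ι → Matrix (QIdx D₁) (QIdx D₁) ℂ}
    (hK : HasSum (fun i => (K i)ᴴ * K i) 1) (A : ι → InfPred (QIdx D₁)) (B : InfPred (QIdx D₂)) :
    (InfPred.sum fun i => conjL (K i) ((A i).tensorId + B.idTensor))
      = (InfPred.sum fun i => (A i).conj (K i)).tensorId + B.idTensor := by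
  refine InfPred.ext (funext fun w => ?_)
  change ∑' i, ((A i).tensorId.form _ + B.idTensor.form _) = (∑ k, ∑' i, _) + _
  rw [ENNReal.tsum_add, sum_form_kronecker_one hK]
  congr 1
  rw [← Summable.tsum_finsetSum fun _ _ => ENNReal.summable]
  refine tsum_congr fun i => Finset.sum_congr rfl fun k _ => ?_
  change _ = (A i).form (K i *ᵥ fun j => w (j, k))
  congr 1
  ext j
  simp [Matrix.mulVec, dotProduct, Fintype.sum_prod_type, Matrix.one_apply]

/-- The one-sided preconditions of a Kraus family act only on the right summand of a split
predicate. -/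
theorem sum_conjR_split {ι : Type*} {K : ι → Matrix (QIdx D₂) (QIdx D₂) ℂ}
    (hK : HasSum (fun i => (K i)ᴴ * K i) 1) (A : InfPred (QIdx D₁)) (B : ι → InfPred (QIdx D₂)) :
    (InfPred.sum fun i => conjR (K i) (A.tensorId + (B i).idTensor))
      = A.tensorId + (InfPred.sum fun i => (B i).conj (K i)).idTensor := by
  refine InfPred.ext (funext fun w => ?_)
  change ∑' i, (A.tensorId.form _ + (B i).idTensor.form _) = _ + (∑ k, ∑' i, _)
  rw [ENNReal.tsum_add, sum_form_one_kronecker hK]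
  congr 1
  rw [← Summable.tsum_finsetSum fun _ _ => ENNReal.summable]
  refine tsum_congr fun i => Finset.sum_congr rfl fun k _ => ?_
  change _ = (B i).form (K i *ᵥ fun j => w (k, j))
  congr 1
  ext j
  simp [Matrix.mulVec, dotProduct, Fintype.sum_prod_type_right, Matrix.one_apply]

theorem sum_unit {n : Type*} [Fintype n] [DecidableEq n] (A : Unit → InfPred n) :
    InfPred.sum A = A () :=
  InfPred.ext (funext fun u =>
    (tsum_fintype (L := .unconditional _) fun i => (A i).form u).trans (Fintype.sum_unique _))

theorem sum_smul_split_left (μ : PMF V) (A : V → InfPred (QIdx D₁)) (B : InfPred (QIdx D₂)) :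
    (InfPred.sum fun v => μ v • ((A v).tensorId + B.idTensor))
      = (InfPred.sum fun v => μ v • A v).tensorId + B.idTensor := by
  refine InfPred.ext (funext fun w => ?_)
  change ∑' v, μ v * ((A v).tensorId.form w + B.idTensor.form w) = (∑ k, ∑' v, _) + _
  simp only [mul_add]
  rw [ENNReal.tsum_add, ENNReal.tsum_mul_right, μ.tsum_coe, one_mul]
  congr 1
  rw [← Summable.tsum_finsetSum fun _ _ => ENNReal.summable]
  exact tsum_congr fun v => Finset.mul_sum _ _ _

theorem sum_smul_split_right (μ : PMF V) (A : InfPred (QIdx D₁)) (B : V → InfPred (QIdx D₂)) :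
    (InfPred.sum fun v => μ v • (A.tensorId + (B v).idTensor))
      = A.tensorId + (InfPred.sum fun v => μ v • B v).idTensor := by
  refine InfPred.ext (funext fun w => ?_)
  change ∑' v, μ v * (A.tensorId.form w + (B v).idTensor.form w) = _ + (∑ k, ∑' v, _)
  simp only [mul_add]
  rw [ENNReal.tsum_add, ENNReal.tsum_mul_right, μ.tsum_coe, one_mul]
  congr 1
  rw [← Summable.tsum_finsetSum fun _ _ => ENNReal.summable]
  exact tsum_congr fun v => Finset.mul_sum _ _ _

/-- The one-sided rules derive the weakest precondition of a command on the left. For a loop the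
weakest precondition is the invariant. -/
theorem derivable_wp_left [Nonempty V] [∀ q, Nonempty (D₁ q)] {c : Cmd C₁ V D₁} (hc : HAST c)
    (φ₁ : Assn C₁ V D₁) (φ₂ : Assn C₂ V D₂) :
    Derivable (split (wp c φ₁) φ₂) c .skip (split φ₁ φ₂) := by
  induction c generalizing φ₁ with
  | skip => exact .skip _
  | abort => exact (not_ast_abort hc).elim
  | assign x e => exact .assignL (D₁ := D₁) x e (split φ₁ φ₂)
  | sample x μ =>
    convert Derivable.sampleL x μ (split φ₁ φ₂) using 1
    exact funext fun σ => (sum_smul_split_left _ _ _).symm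
  | init S v =>
    convert Derivable.initL (D₁ := D₁) S v (split φ₁ φ₂) using 1
    exact funext fun σ => (sum_conjL_split (hasSum_initOp S (v σ.1)) (fun _ => φ₁ σ.1) _).symm
  | apply S U =>
    convert Derivable.applyL (D₁ := D₁) S U (split φ₁ φ₂) using 1
    funext σ
    have := sum_conjL_split (hasSum_unitary S U) (fun _ => φ₁ σ.1) (φ₂ σ.2)
    rw [sum_unit, sum_unit] at this
    exact this.symm
  | meas x S M =>
    convert Derivable.measL x S M (split φ₁ φ₂) using 1
    exact funext fun σ => (sum_conjL_split (hasSum_embed M.complete) _ _).symm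
  | seq c c' ih ih' =>
    exact .skipSeqR _ _ _ _ (.seq _ _ _ _ _ _ _ (ih hc.2.1 (wp c' φ₁)) (ih' hc.2.2 φ₁))
  | ite b c c' ih ih' =>
    refine .ifL _ _ _ _ _ _ ((ih hc.2.1 φ₁).of_le (fun σ => ?_) fun _ _ => le_rfl)
      ((ih' hc.2.2 φ₁).of_le (fun σ => ?_) fun _ _ => le_rfl)
    all_goals
      refine InfPred.le_guard fun hb => ?_
      simp only [split, wp, hb]
      exact fun _ => le_rfl
  | loop b c ih =>
    refine Derivable.of_le (.whileL b c (split (wp (.loop b c) φ₁) φ₂)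
      ((ih hc.2 (wp (.loop b c) φ₁)).of_le (fun σ => ?_) fun _ _ => le_rfl) hc.1)
      (fun _ _ => le_rfl) fun σ => ?_
    · refine InfPred.le_guard fun hb => ?_
      simp only [split, wp_loop_of_true _ hb]
      exact fun _ => le_rfl
    -- where the guard holds, the postcondition of the loop rule is `∞ • I`
    · refine InfPred.le_guard fun hb => ?_
      simp only [split, wp_loop_of_false _ hb]
      exact fun _ => le_rfl

/-- The one-sided rules derive the weakest precondition of a command on the right. -/
theorem derivable_wp_right [Nonempty V] [∀ q, Nonempty (D₂ q)] {c : Cmd C₂ V D₂} (hc : HAST c)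
    (φ₁ : Assn C₁ V D₁) (φ₂ : Assn C₂ V D₂) :
    Derivable (split φ₁ (wp c φ₂)) .skip c (split φ₁ φ₂) := by
  induction c generalizing φ₂ with
  | skip => exact .skip _
  | abort => exact (not_ast_abort hc).elim
  | assign x e => exact .assignR (D₂ := D₂) x e (split φ₁ φ₂)
  | sample x μ =>
    convert Derivable.sampleR x μ (split φ₁ φ₂) using 1
    exact funext fun σ => (sum_smul_split_right _ _ _).symm
  | init S v =>
    convert Derivable.initR (D₂ := D₂) S v (split φ₁ φ₂) using 1
    exact funext fun σ => (sum_conjR_split (hasSum_initOp S (v σ.2)) _ (fun _ => φ₂ σ.2)).symm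
  | apply S U =>
    convert Derivable.applyR (D₂ := D₂) S U (split φ₁ φ₂) using 1
    funext σ
    have := sum_conjR_split (hasSum_unitary S U) (φ₁ σ.1) (fun _ => φ₂ σ.2)
    rw [sum_unit, sum_unit] at this
    exact this.symm
  | meas x S M =>
    convert Derivable.measR x S M (split φ₁ φ₂) using 1
    exact funext fun σ => (sum_conjR_split (hasSum_embed M.complete) _ _).symm
  | seq c c' ih ih' =>
    exact .skipSeqL _ _ _ _ (.seq _ _ _ _ _ _ _ (ih hc.2.1 (wp c' φ₂)) (ih' hc.2.2 φ₂))
  | ite b c c' ih ih' =>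
    refine .ifR _ _ _ _ _ _ ((ih hc.2.1 φ₂).of_le (fun σ => ?_) fun _ _ => le_rfl)
      ((ih' hc.2.2 φ₂).of_le (fun σ => ?_) fun _ _ => le_rfl)
    all_goals
      refine InfPred.le_guard fun hb => ?_
      simp only [split, wp, hb]
      exact fun _ => le_rfl
  | loop b c ih =>
    refine Derivable.of_le (.whileR b c (split φ₁ (wp (.loop b c) φ₂))
      ((ih hc.2 (wp (.loop b c) φ₂)).of_le (fun σ => ?_) fun _ _ => le_rfl) hc.1)
      (fun _ _ => le_rfl) fun σ => ?_
    · refine InfPred.le_guard fun hb => ?_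
      simp only [split, wp_loop_of_true _ hb]
      exact fun _ => le_rfl
    -- where the guard holds, the postcondition of the loop rule is `∞ • I`
    · refine InfPred.le_guard fun hb => ?_
      simp only [split, wp_loop_of_false _ hb]
      exact fun _ => le_rfl

theorem derivable_wp [Nonempty V] [∀ q, Nonempty (D₁ q)] [∀ q, Nonempty (D₂ q)]
    {c₁ : Cmd C₁ V D₁} {c₂ : Cmd C₂ V D₂} (h₁ : HAST c₁) (h₂ : HAST c₂)
    (φ₁ : Assn C₁ V D₁) (φ₂ : Assn C₂ V D₂) :
    Derivable (split (wp c₁ φ₁) (wp c₂ φ₂)) c₁ c₂ (split φ₁ φ₂) :=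
  .seqSkipL _ _ _ _ (.skipSeqR _ _ _ _ (.seq _ _ _ _ _ _ _
    (derivable_wp_left h₁ φ₁ (wp c₂ φ₂)) (derivable_wp_right h₂ φ₁ φ₂)))

/-! ### Split postconditions below a valid postcondition -/

/-- Weak duality: a valid precondition, shifted by `k`, dominates the weakest precondition of every
split assertion below the postcondition shifted by `k`. -/
theorem Valid.expectation_wp_le {ψ φ : RAssn C₁ C₂ V D₁ D₂} {c₁ : Cmd C₁ V D₁} {c₂ : Cmd C₂ V D₂}
    (h : Valid ψ c₁ c₂ φ) {k : ℕ} {φ₁ : Assn C₁ V D₁} {φ₂ : Assn C₂ V D₂}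
    (hφ : ∀ σ, split φ₁ φ₂ σ ≤ addConst φ k σ) (Δ : RState C₁ C₂ V D₁ D₂) :
    expectation Δ.val (split (wp c₁ φ₁) (wp c₂ φ₂)) ≤ expectation Δ.val (addConst ψ k) := by
  obtain ⟨Δ', ⟨e₁, e₂⟩, hle⟩ := h Δ
  have ht := Δ.totalTrace_ne_top
  have t₁ := totalTrace_marg₂ Δ.psd ht
  have t₂ := totalTrace_marg₁ Δ.psd ht
  obtain ⟨-, l₁, w₁⟩ := adequate_wp c₁ (marg₂ Δ.val) (posSemidef_marg₂ Δ.psd) (t₁ ▸ ht)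
  obtain ⟨-, -, w₂⟩ := adequate_wp c₂ (marg₁ Δ.val) (posSemidef_marg₁ Δ.psd) (t₂ ▸ ht)
  calc expectation Δ.val (split (wp c₁ φ₁) (wp c₂ φ₂))
      = expectation Δ'.val (split φ₁ φ₂) := by
        rw [expectation_split, expectation_split, e₁, e₂, w₁, w₂]
    _ ≤ expectation Δ'.val (addConst φ k) := expectation_mono Δ'.psd hφ
    _ = expectation Δ'.val φ + k * totalTrace Δ'.val := expectation_addConst _ _ _
    _ ≤ expectation Δ.val ψ + k * totalTrace Δ.val := by
        gcongr
        rw [← totalTrace_marg₂ Δ'.psd Δ'.totalTrace_ne_top, e₁, ← t₁]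
        exact l₁
    _ = expectation Δ.val (addConst ψ k) := (expectation_addConst _ _ _).symm

end Derivations

end CqOTL

end

theorem theorem8p2 {C₁ C₂ V Q₁ Q₂ : Type*} {D₁ : Q₁ → Type*} {D₂ : Q₂ → Type*}
    [DecidableEq C₁] [DecidableEq C₂] [Nonempty V] [∀ q, Nonempty (D₁ q)] [∀ q, Nonempty (D₂ q)]
    [Fintype Q₁] [DecidableEq Q₁] [∀ q, Fintype (D₁ q)] [∀ q, DecidableEq (D₁ q)]
    [Fintype Q₂] [DecidableEq Q₂] [∀ q, Fintype (D₂ q)] [∀ q, DecidableEq (D₂ q)]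
    (c₁ : CqOTL.Cmd C₁ V D₁) (c₂ : CqOTL.Cmd C₂ V D₂) (h₁ : CqOTL.HAST c₁) (h₂ : CqOTL.HAST c₂)
    (ψ φ : CqOTL.RAssn C₁ C₂ V D₁ D₂) (h : CqOTL.Valid ψ c₁ c₂ φ) :
    CqOTL.Derivable ψ c₁ c₂ φ := by
  refine .duality _ _ _ _ h₁.ast h₂.ast ?_
  rintro ⟨k, φ₁, φ₂⟩ ⟨-, -, hφ⟩
  exact (CqOTL.derivable_wp h₁ h₂ φ₁ φ₂).of_expectation_le (h.expectation_wp_le hφ)
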